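/- Let $n\ge 6$, $m\ge 1$ and $k\ge n+m$ be integers, and let $k$ qubits be placed on a line, at positions $1,\dots,k$. Let $c_1,\dots,c_n,t_1,\dots,t_m$ be pairwise distinct qubits among them, at arbitrary positions and in arbitrary order (the remaining $k-n-m$ qubits are idle and may be in any state), put $C=\{c_1,\dots,c_n\}$, and let $W_1,\dots,W_m\in SU(2)$. Let $$G=\prod_{j=1}^m \Lambda_C^{t_j}(W_j),$$ where $\Lambda_C^{t}(W)$ applies $W$ to the qubit $t$ if all qubits in $C$ are in the state $|1\rangle$ and acts as the identity otherwise. Then there is a circuit on the $k$ qubits that implements $G$ exactly as an operator on the $k$-qubit space (so it acts as the identity on the idle qubits), which consists only of rotations $R_{\hat x}(\theta)=e^{-i\theta X/2}$ and $R_{\hat z}(\theta)=e^{-i\theta Z/2}$ with arbitrary $\theta\in\mathbb R$, of $H$ gates, of $T=\mathrm{diag}(1,e^{i\pi/4})$ gates and their inverses (both counted as $T$ gates), and of CNOT gates each of which acts, in either direction, on two neighboring qubits of the line (linear-nearest-neighbor connectivity), such that the circuit uses $8m$ gates from $\{R_{\hat x},R_{\hat z}\}$ and, in addition, no more than * CNOT: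 cost $24k+14n-40$ and depth $24k+5n-4$; * T: cost $16n-32$ and depth $4n$; * H: cost $8n-8$ and depth $4n$. Here a circuit is a sequence of time slots, each of which holds gates acting on pairwise disjoint sets of qubits; the cost of a gate type is the number of gates of that type in the circuit, and its depth is the number of time slots that hold at least one gate of that type. -/

import Mathlib

namespace LNNCircuit

/-- Computational basis states of `k` qubits placed on a line at positions `0, …, k - 1`. -/
abbrev Basis (k : ℕ) : Type := Fin k → Fin 2

/-- Operators on the state space of `k` qubits, as matrices in the computational basis. -/
abbrev Op (k : ℕ) : Type := Matrix (Basis k) (Basis k) ℂ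

/-- The gate that applies `U` to the qubit `t` if every qubit of `C` is in state `1`, and the
identity otherwise.  All qubits other than `t` are left unchanged. -/
noncomputable def controlled {k : ℕ} (C : Finset (Fin k)) (t : Fin k)
    (U : Matrix (Fin 2) (Fin 2) ℂ) : Op k :=
  Matrix.of fun x y =>
    if ∀ j, j ≠ t → x j = y j then
      (if ∀ c ∈ C, y c = 1 then U (x t) (y t) else (1 : Matrix (Fin 2) (Fin 2) ℂ) (x t) (y t))
    else 0

/-- The multi-controlled multi-target gate: the product of the gates that apply `W j` to the qubit
`τ j`, each controlled by all the qubits of `C`. -/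
noncomputable def multiControlledMultiTarget {k m : ℕ} (C : Finset (Fin k)) (τ : Fin m → Fin k)
    (W : Fin m → Matrix (Fin 2) (Fin 2) ℂ) : Op k :=
  (List.ofFn fun j => controlled C (τ j) (W j)).prod

/-- Rotation by the angle `θ` about the `x` axis, `exp (-i θ X / 2)`. -/
noncomputable def rotX (θ : ℝ) : Matrix (Fin 2) (Fin 2) ℂ :=
  !![(Real.cos (θ / 2) : ℂ), -Complex.I * (Real.sin (θ / 2) : ℂ);
     -Complex.I * (Real.sin (θ / 2) : ℂ), (Real.cos (θ / 2) : ℂ)]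

/-- Rotation by the angle `θ` about the `z` axis, `exp (-i θ Z / 2)`. -/
noncomputable def rotZ (θ : ℝ) : Matrix (Fin 2) (Fin 2) ℂ :=
  !![Complex.exp (-(Complex.I * (θ / 2 : ℝ))), 0;
     0, Complex.exp (Complex.I * (θ / 2 : ℝ))]

/-- The phase gate `diag (1, exp (i φ))`. -/
noncomputable def phase (φ : ℝ) : Matrix (Fin 2) (Fin 2) ℂ :=
  !![1, 0; 0, Complex.exp (Complex.I * (φ : ℂ))]

/-- The Hadamard matrix. -/
noncomputable def hadamard : Matrix (Fin 2) (Fin 2) ℂ :=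
  ((1 / Real.sqrt 2 : ℝ) : ℂ) • !![1, 1; 1, -1]

/-- The Pauli `X` matrix. -/
def pauliX : Matrix (Fin 2) (Fin 2) ℂ := !![0, 1; 1, 0]

/-- The elementary gates, together with the qubits on which they act.  `tdg` is the inverse of the
`T` gate; `cnot c q` has control `c` and target `q`. -/
inductive Gate (k : ℕ) : Type
  | rx (θ : ℝ) (q : Fin k)
  | rz (θ : ℝ) (q : Fin k)
  | h (q : Fin k)
  | t (q : Fin k)
  | tdg (q : Fin k)
  | cnot (c q : Fin k)

namespace Gate

variable {k : ℕ}

/-- The operator that an elementary gate performs on the `k` qubits. -/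
noncomputable def toOp : Gate k → Op k
  | rx θ q => controlled ∅ q (rotX θ)
  | rz θ q => controlled ∅ q (rotZ θ)
  | h q => controlled ∅ q hadamard
  | t q => controlled ∅ q (phase (Real.pi / 4))
  | tdg q => controlled ∅ q (phase (-(Real.pi / 4)))
  | cnot c q => controlled {c} q pauliX

/-- The qubits on which a gate acts. -/
def qubits : Gate k → Finset (Fin k)
  | rx _ q => {q}
  | rz _ q => {q}
  | h q => {q}
  | t q => {q}
  | tdg q => {q}
  | cnot c q => {c, q}

/-- Linear-nearest-neighbor connectivity: a CNOT gate may act (in either direction) only on two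
qubits in neighboring positions. -/
def IsLNN : Gate k → Prop
  | cnot c q => (c : ℕ) + 1 = q ∨ (q : ℕ) + 1 = c
  | _ => True

/-- Is the gate a rotation about the `x` or `z` axis? -/
def isRotation : Gate k → Bool
  | rx _ _ => true
  | rz _ _ => true
  | _ => false

/-- Is the gate a CNOT gate? -/
def isCNOT : Gate k → Bool
  | cnot _ _ => true
  | _ => false

/-- Is the gate a `T` gate or its inverse?  Both count as `T` gates. -/
def isT : Gate k → Bool
  | t _ => true
  | tdg _ => true
  | _ => false

/-- Is the gate a Hadamard gate? -/
def isH : Gate k → Bool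
  | h _ => true
  | _ => false

end Gate

/-- A circuit is a list of time slots, the first one being executed first; a time slot is a list
of gates that are executed in parallel. -/
abbrev Circuit (k : ℕ) : Type := List (List (Gate k))

namespace Circuit

variable {k : ℕ}

/-- The circuit can be executed in linear-nearest-neighbor connectivity: every CNOT gate acts on
neighboring qubits, and the gates of a time slot act on pairwise disjoint sets of qubits. -/
def IsLNN (c : Circuit k) : Prop :=
  ∀ slot ∈ c, (∀ g ∈ slot, g.IsLNN) ∧ slot.Pairwise fun g g' => Disjoint g.qubits g'.qubits

/-- The operator of a sequence of gates, the head of the list being applied first. -/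
noncomputable def seqOp : List (Gate k) → Op k
  | [] => 1
  | g :: gs => seqOp gs * g.toOp

/-- The operator that a circuit implements. -/
noncomputable def toOp (c : Circuit k) : Op k := seqOp c.flatten

/-- The cost: the number of gates of the kind `p` in the circuit. -/
def cost (c : Circuit k) (p : Gate k → Bool) : ℕ := c.flatten.countP p

/-- The depth: the number of time slots of the circuit that hold a gate of the kind `p`. -/
def depth (c : Circuit k) (p : Gate k → Bool) : ℕ := c.countP fun slot => slot.any p

end Circuit

end LNNCircuit

/-!
Let `z 0 < … < z (n - 1)` be the sorted positions of the controls.  Every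
`W ∈ SU(2)` is `V * rotX θ * V⁻¹` for a product `V` of two rotations (`exists_eq_rotations`), and
`rotX θ` is a product of alternating Pauli `Z` matrices and rotations `rotX (± θ / 4)`
(`pauliZ_rotX_commutator`).  If one of the two kinds of `Z` in this product is left out, the product
collapses to the identity.  So it is enough to replace the `Z` matrices by two diagonal operators
`A`, `B`, each of which is used twice (`B` once inverted) and acts on all the targets together.
The sign of `A` changes with each target bit exactly if the first control is `1`; the phase of `B`
changes sign with each target bit exactly if a predicate `p` of the other qubits holds, where `p`
only has to agree with the conjunction of all the controls on the states whose first control is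
`1`.  The dependence on the non-target qubits is otherwise arbitrary, since it cancels.  The
calculus for this is that of `blockOp`: operators that, for each state of the other qubits, act on
the targets by a scalar times a tensor product (`diagonal_eq_blockOp`, `exists_circuit`).

`A` is a parity between two Hadamard gates (`toOp_signCircuit`): CNOT gates along the line collect
the parity of all qubits other than the first control into it.  The use of all qubits, idle ones
included, makes the cost independent of the positions of the targets.

`B` is `V⁻¹ * D * V` with `D` diagonal.  Four `T` gates on the total parity, shifted by the first
two controls, give a phase in `D` that changes sign with each target bit exactly if the first two
controls are `0` (`fourPhase_add_one`, `toOp_midCircuit`), and `V` is a monomial operator that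
turns the latter condition into the conjunction of all controls (`conjunction_iff`); the phases
of `V` drop out of the conjugation (`mul_diagonal_mul_mono`).  `V` consists of two staircases of
about `n / 2` gadgets each.  A gadget is the same four `T` gates between Hadamard gates, hence up to
phases and up to some further CNOT gates a doubly controlled NOT gate
(`Gadget.exists_seqOp_eq_mono`).  In a staircase the second slot of `T` gates and the last Hadamard
gate of every gadget can be postponed to the end (`seqOp_postpone`), where they share one time slot;
this saves half of the `T` and Hadamard depth (`uses_staircase`).
-/

namespace LNNCircuit

variable {k : ℕ}

open Circuit (seqOp)

/-! ### Products of gates -/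

theorem mul_controlled (M : Op k) {C : Finset (Fin k)} {t : Fin k} (ht : t ∉ C)
    (U : Matrix (Fin 2) (Fin 2) ℂ) (x y : Basis k) :
    (M * controlled C t U) x y =
      ∑ s : Fin 2, M x (Function.update y t s) *
        (if ∀ c ∈ C, y c = 1 then U else 1) s (y t) := by
  rw [Matrix.mul_apply]
  symm
  apply Fintype.sum_of_injective (fun s : Fin 2 => Function.update y t s)
  · exact Function.update_injective y t
  · intro z hz
    have : ¬ ∀ j, j ≠ t → z j = y j := by
      intro h
      apply hz
      refine ⟨z t, ?_⟩
      funext j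
      by_cases hj : j = t
      · subst hj; simp
      · simp [hj, h j hj]
    simp [controlled, this]
  · intro s
    have h1 : ∀ j, j ≠ t → Function.update y t s j = y j := by
      intro j hj; simp [hj]
    have h2 : Function.update y t s t = s := Function.update_self ..
    simp only [controlled, Matrix.of_apply, if_pos h1]
    rw [h2]
    split_ifs <;> rfl

theorem controlled_mul (M : Op k) (t : Fin k)
    (U : Matrix (Fin 2) (Fin 2) ℂ) (x y : Basis k) :
    (controlled ∅ t U * M) x y = ∑ s : Fin 2, U (x t) s * M (Function.update x t s) y := by
  rw [Matrix.mul_apply]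
  symm
  apply Fintype.sum_of_injective (fun s : Fin 2 => Function.update x t s)
  · exact Function.update_injective x t
  · intro z hz
    have : ¬ ∀ j, j ≠ t → x j = z j := by
      intro h
      apply hz
      refine ⟨z t, ?_⟩
      funext j
      by_cases hj : j = t
      · subst hj; simp
      · simp [hj, h j hj]
    simp [controlled, this]
  · intro s
    have h1 : ∀ j, j ≠ t → x j = Function.update x t s j := by
      intro j hj; simp [hj]
    simp [controlled, if_pos h1]

theorem controlled_one (C : Finset (Fin k)) (t : Fin k) : controlled C t 1 = 1 := by
  ext x y
  simp only [controlled, Matrix.of_apply, ite_self, Matrix.one_apply]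
  by_cases h : x = y
  · subst h; simp
  · rw [if_neg h]
    split_ifs with h1 h2
    · exact absurd (funext fun j => if hj : j = t then by rw [hj]; exact h2 else h1 j hj) h
    · rfl
    · rfl

theorem controlled_mul_controlled {C : Finset (Fin k)} {t : Fin k} (ht : t ∉ C)
    (U U' : Matrix (Fin 2) (Fin 2) ℂ) :
    controlled C t U * controlled C t U' = controlled C t (U * U') := by
  ext x y
  rw [mul_controlled _ ht]
  have hC : ∀ s, (∀ c ∈ C, Function.update y t s c = 1) ↔ ∀ c ∈ C, y c = 1 := by
    intro s
    refine forall₂_congr fun c hc => ?_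
    rw [Function.update_of_ne (by rintro rfl; exact ht hc)]
  have hx : ∀ s, (∀ j, j ≠ t → x j = Function.update y t s j) ↔ ∀ j, j ≠ t → x j = y j := by
    intro s
    refine forall₂_congr fun c hc => ?_
    rw [Function.update_of_ne hc]
  simp only [controlled, Matrix.of_apply, hC, hx, Function.update_self]
  by_cases h1 : ∀ j, j ≠ t → x j = y j
  · by_cases h2 : ∀ c ∈ C, y c = 1
    · simp only [if_pos h1, if_pos h2, Matrix.mul_apply]
    · simp [if_pos h1, if_neg h2, Matrix.one_apply]
  · simp [if_neg h1]

theorem controlled_commute {C C' : Finset (Fin k)} {t t' : Fin k} (ht : t ∉ C) (ht' : t' ∉ C')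
    (hd : Disjoint (insert t C) (insert t' C')) (U U' : Matrix (Fin 2) (Fin 2) ℂ) :
    Commute (controlled C t U) (controlled C' t' U') := by
  rw [Finset.disjoint_left] at hd
  have htt : t ≠ t' := by
    rintro rfl
    exact hd (Finset.mem_insert_self _ _) (Finset.mem_insert_self _ _)
  have h1 : ∀ (y : Basis k) s, (∀ c ∈ C, Function.update y t' s c = 1) ↔ ∀ c ∈ C, y c = 1 := by
    intro y s
    refine forall₂_congr fun c hc => ?_
    rw [Function.update_of_ne]
    rintro rfl
    exact hd (Finset.mem_insert_of_mem hc) (Finset.mem_insert_self _ _)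
  have h2 : ∀ (y : Basis k) s, (∀ c ∈ C', Function.update y t s c = 1) ↔ ∀ c ∈ C', y c = 1 := by
    intro y s
    refine forall₂_congr fun c hc => ?_
    rw [Function.update_of_ne]
    rintro rfl
    exact hd (Finset.mem_insert_self _ _) (Finset.mem_insert_of_mem hc)
  unfold Commute SemiconjBy
  rw [← Matrix.one_mul (controlled C t U * _), ← Matrix.one_mul (controlled C' t' U' * _),
    ← Matrix.mul_assoc, ← Matrix.mul_assoc]
  ext x y
  simp only [mul_controlled _ ht, mul_controlled _ ht', h1, h2, Finset.sum_mul,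
    Function.update_of_ne htt, Function.update_of_ne htt.symm]
  rw [Finset.sum_comm]
  refine Finset.sum_congr rfl fun s _ => Finset.sum_congr rfl fun r _ => ?_
  rw [Function.update_comm htt]
  ring

/-- A gate is well formed if a CNOT gate has its control and its target on different qubits. -/
def Gate.WF : Gate k → Prop
  | .cnot c q => c ≠ q
  | _ => True

theorem Gate.toOp_eq_controlled (g : Gate k) (hg : g.WF) :
    ∃ C t U, g.toOp = controlled C t U ∧ t ∉ C ∧ g.qubits = insert t C := by
  cases g with
  | cnot c q =>
    refine ⟨{c}, q, pauliX, rfl, ?_, ?_⟩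
    · simpa using fun h : q = c => hg h.symm
    · simp [Gate.qubits, Finset.pair_comm]
  | _ => exact ⟨∅, _, _, rfl, by simp, rfl⟩

theorem Gate.commute_of_disjoint {g g' : Gate k} (hg : g.WF) (hg' : g'.WF)
    (hd : Disjoint g.qubits g'.qubits) : Commute g.toOp g'.toOp := by
  obtain ⟨C, t, U, h1, h2, h3⟩ := g.toOp_eq_controlled hg
  obtain ⟨C', t', U', h1', h2', h3'⟩ := g'.toOp_eq_controlled hg'
  rw [h1, h1']
  exact controlled_commute h2 h2' (by rw [← h3, ← h3']; exact hd) _ _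

@[simp] theorem seqOp_nil : seqOp ([] : List (Gate k)) = 1 := rfl

@[simp] theorem seqOp_cons (g : Gate k) (l : List (Gate k)) :
    seqOp (g :: l) = seqOp l * g.toOp := rfl

theorem seqOp_append (l l' : List (Gate k)) : seqOp (l ++ l') = seqOp l' * seqOp l := by
  induction l with
  | nil => simp
  | cons g l ih => simp [ih, mul_assoc]

theorem seqOp_commute {l l' : List (Gate k)} (hl : ∀ g ∈ l, g.WF) (hl' : ∀ g ∈ l', g.WF)
    (hd : ∀ g ∈ l, ∀ g' ∈ l', Disjoint g.qubits g'.qubits) :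
    Commute (seqOp l) (seqOp l') := by
  induction l with
  | nil => exact Commute.one_left _
  | cons g l ih =>
    rw [seqOp_cons]
    refine Commute.mul_left (ih (fun g' h => hl g' (by simp [h])) fun g' h => hd g' (by simp [h])) ?_
    clear ih
    induction l' with
    | nil => exact Commute.one_right _
    | cons g' l' ih =>
      rw [seqOp_cons]
      refine Commute.mul_right (ih (fun g' h => hl' g' (by simp [h])) ?_) ?_
      · exact fun a ha b hb => hd a ha b (by simp [hb])
      · exact Gate.commute_of_disjoint (hl g (by simp)) (hl' g' (by simp))
          (hd g (by simp) g' (by simp))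

/-! ### Inverse circuits -/

/-- The inverse of an elementary gate. -/
def Gate.inv : Gate k → Gate k
  | .rx θ q => .rx (-θ) q
  | .rz θ q => .rz (-θ) q
  | .h q => .h q
  | .t q => .tdg q
  | .tdg q => .t q
  | .cnot c q => .cnot c q

theorem rotX_mul (a b : ℝ) : rotX a * rotX b = rotX (a + b) := by
  have e : (a + b) / 2 = a / 2 + b / 2 := by ring
  unfold rotX
  rw [e, Real.cos_add, Real.sin_add]
  ext i j
  fin_cases i <;> fin_cases j <;>
    simp [Matrix.mul_apply, Fin.sum_univ_two] <;> ring_nf <;> simp <;> ring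

theorem rotZ_mul (a b : ℝ) : rotZ a * rotZ b = rotZ (a + b) := by
  unfold rotZ
  ext i j
  fin_cases i <;> fin_cases j <;>
    simp [Matrix.mul_apply, Fin.sum_univ_two, ← Complex.exp_add] <;> congr 1 <;> ring

theorem rotX_zero : rotX 0 = 1 := by
  ext i j
  fin_cases i <;> fin_cases j <;> simp [rotX]

theorem rotZ_zero : rotZ 0 = 1 := by
  ext i j
  fin_cases i <;> fin_cases j <;> simp [rotZ]

theorem phase_mul (a b : ℝ) : phase a * phase b = phase (a + b) := by
  unfold phase
  ext i j
  fin_cases i <;> fin_cases j <;>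
    simp [Matrix.mul_apply, Fin.sum_univ_two, ← Complex.exp_add]
  congr 1; ring

theorem phase_zero : phase 0 = 1 := by
  ext i j
  fin_cases i <;> fin_cases j <;> simp [phase]

theorem pauliX_mul_self : pauliX * pauliX = 1 := by
  ext i j
  fin_cases i <;> fin_cases j <;> simp [pauliX]

theorem one_div_sqrt_two_sq :
    (((1 / Real.sqrt 2 : ℝ) : ℂ)) * ((1 / Real.sqrt 2 : ℝ) : ℂ) = 1 / 2 := by
  rw [← Complex.ofReal_mul, div_mul_div_comm, Real.mul_self_sqrt (by norm_num)]
  norm_num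

theorem hadamard_apply (i j : Fin 2) :
    hadamard i j = ((1 / Real.sqrt 2 : ℝ) : ℂ) * (if i = 1 ∧ j = 1 then -1 else 1) := by
  fin_cases i <;> fin_cases j <;> simp [hadamard]

theorem hadamard_mul_self : hadamard * hadamard = 1 := by
  have h := one_div_sqrt_two_sq
  ext i j
  simp only [Matrix.mul_apply, Fin.sum_univ_two, hadamard_apply]
  generalize ((1 / Real.sqrt 2 : ℝ) : ℂ) = r at h ⊢
  fin_cases i <;> fin_cases j <;> simp <;> linear_combination 2 * h

theorem Gate.inv_toOp_mul (g : Gate k) (hg : g.WF) : g.inv.toOp * g.toOp = 1 := by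
  cases g with
  | rx θ q =>
    simp [Gate.inv, Gate.toOp, controlled_mul_controlled, rotX_mul, rotX_zero, controlled_one]
  | rz θ q =>
    simp [Gate.inv, Gate.toOp, controlled_mul_controlled, rotZ_mul, rotZ_zero, controlled_one]
  | h q =>
    simp [Gate.inv, Gate.toOp, controlled_mul_controlled, hadamard_mul_self, controlled_one]
  | t q =>
    simp [Gate.inv, Gate.toOp, controlled_mul_controlled, phase_mul, phase_zero, controlled_one]
  | tdg q =>
    simp [Gate.inv, Gate.toOp, controlled_mul_controlled, phase_mul, phase_zero, controlled_one]
  | cnot c q =>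
    have : q ∉ ({c} : Finset (Fin k)) := by simpa using fun h : q = c => hg h.symm
    simp [Gate.inv, Gate.toOp, controlled_mul_controlled this, pauliX_mul_self, controlled_one]

/-- The inverse of a sequence of gates: the inverse gates in the opposite order. -/
def invGates (l : List (Gate k)) : List (Gate k) := (l.map Gate.inv).reverse

theorem invGates_append (l l' : List (Gate k)) :
    invGates (l ++ l') = invGates l' ++ invGates l := by
  simp [invGates]

theorem invGates_cons (g : Gate k) (l : List (Gate k)) :
    invGates (g :: l) = invGates l ++ [g.inv] := by
  simp [invGates]

theorem seqOp_invGates_mul {l : List (Gate k)} (hl : ∀ g ∈ l, g.WF) :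
    seqOp (invGates l) * seqOp l = 1 := by
  induction l with
  | nil => simp [invGates]
  | cons g l ih =>
    rw [invGates_cons, seqOp_append, seqOp_cons]
    have := ih fun g' h => hl g' (by simp [h])
    calc _ = g.inv.toOp * (seqOp (invGates l) * seqOp l) * g.toOp := by
          simp [mul_assoc]
      _ = 1 := by rw [this, mul_one, Gate.inv_toOp_mul g (hl g (by simp))]

/-! ### Monomial operators -/

/-- The monomial operator that sends the basis state `y` to `φ y` times the basis state `π y`. -/
noncomputable def mono (π : Basis k → Basis k) (φ : Basis k → ℂ) : Op k :=
  Matrix.of fun x y => if x = π y then φ y else 0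

theorem mono_apply (π : Basis k → Basis k) (φ : Basis k → ℂ) (x y : Basis k) :
    mono π φ x y = if x = π y then φ y else 0 := rfl

theorem mul_mono (M : Op k) (π : Basis k → Basis k) (φ : Basis k → ℂ) (x y : Basis k) :
    (M * mono π φ) x y = M x (π y) * φ y := by
  simp [Matrix.mul_apply, mono_apply]

theorem mono_mul_mono (π π' : Basis k → Basis k) (φ φ' : Basis k → ℂ) :
    mono π φ * mono π' φ' = mono (π ∘ π') (fun y => φ (π' y) * φ' y) := by
  ext x y
  rw [mul_mono, mono_apply, mono_apply]
  simp only [Function.comp]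
  split_ifs <;> simp

theorem mono_id_one : mono (id : Basis k → Basis k) (fun _ => 1) = 1 := by
  ext x y
  simp [mono_apply, Matrix.one_apply]

/-- The gates that act as monomial operators and appear in the constructions: CNOT, `T` and its
inverse. -/
def Gate.Classical : Gate k → Prop
  | .cnot c q => c ≠ q
  | .t _ => True
  | .tdg _ => True
  | _ => False

/-- The action of a CNOT gate on basis states; the other gates are treated as the identity. -/
def Gate.flow : Gate k → Basis k → Basis k
  | .cnot c q => fun y => Function.update y q (y q + y c)
  | _ => id

/-- The phase of `T` (for `true`) or of its inverse (for `false`) on a qubit in the state `b`. -/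
noncomputable def tPhase (s : Bool) (b : Fin 2) : ℂ :=
  if b = 1 then Complex.exp (Complex.I * ((if s then Real.pi / 4 else -(Real.pi / 4) : ℝ) : ℂ))
  else 1

/-- The phase that a `T` gate or its inverse attaches to a basis state; for the other gates, `1`. -/
noncomputable def Gate.ph : Gate k → Basis k → ℂ
  | .t q => fun y => tPhase true (y q)
  | .tdg q => fun y => tPhase false (y q)
  | _ => fun _ => 1

theorem Gate.toOp_eq_mono {g : Gate k} (hg : g.Classical) : g.toOp = mono g.flow g.ph := by
  have hdiag : ∀ (s : Bool) (q : Fin k) (x y : Basis k),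
      ((1 : Op k) * controlled ∅ q (phase (if s then Real.pi / 4 else -(Real.pi / 4)))) x y =
      if x = y then tPhase s (y q) else 0 := by
    intro s q x y
    rw [mul_controlled _ (by simp)]
    have hb : ∀ b : Fin 2, b = 0 ∨ b = 1 := by decide
    rcases hb (y q) with h | h
    · have e : Function.update y q 0 = y := by rw [← h]; simp
      simp [Fin.sum_univ_two, phase, h, e, Matrix.one_apply, tPhase]
    · have e : Function.update y q 1 = y := by rw [← h]; simp
      simp [Fin.sum_univ_two, phase, h, e, Matrix.one_apply, tPhase]
  cases g with
  | t q =>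
    ext x y
    have := hdiag true q x y
    rw [one_mul] at this
    simpa [Gate.toOp, mono_apply, Gate.flow, Gate.ph] using this
  | tdg q =>
    ext x y
    have := hdiag false q x y
    rw [one_mul] at this
    simpa [Gate.toOp, mono_apply, Gate.flow, Gate.ph] using this
  | cnot c q =>
    have hq : q ∉ ({c} : Finset (Fin k)) := by simpa using fun h : q = c => hg h.symm
    ext x y
    rw [← one_mul (Gate.toOp _), Gate.toOp, mul_controlled _ hq, mono_apply]
    have hb : ∀ b : Fin 2, b = 0 ∨ b = 1 := by decide
    rcases hb (y c) with hc | hc <;> rcases hb (y q) with h | h <;>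
      simp [Fin.sum_univ_two, pauliX, h, hc, Matrix.one_apply, Gate.flow, Gate.ph]
  | rx _ _ => exact hg.elim
  | rz _ _ => exact hg.elim
  | h _ => exact hg.elim

/-- The basis state into which a sequence of gates sends a basis state. -/
def flowL : List (Gate k) → Basis k → Basis k
  | [], y => y
  | g :: l, y => flowL l (g.flow y)

/-- The phase that a sequence of gates attaches to a basis state. -/
noncomputable def phL : List (Gate k) → Basis k → ℂ
  | [], _ => 1
  | g :: l, y => phL l (g.flow y) * g.ph y

theorem flowL_append (l l' : List (Gate k)) (y : Basis k) :
    flowL (l ++ l') y = flowL l' (flowL l y) := by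
  induction l generalizing y with
  | nil => rfl
  | cons g l ih => exact ih _

theorem phL_append (l l' : List (Gate k)) (y : Basis k) :
    phL (l ++ l') y = phL l' (flowL l y) * phL l y := by
  induction l generalizing y with
  | nil => simp [phL, flowL]
  | cons g l ih => simp [phL, flowL, ih, mul_assoc]

theorem seqOp_eq_mono {l : List (Gate k)} (hl : ∀ g ∈ l, g.Classical) :
    seqOp l = mono (flowL l) (phL l) := by
  induction l with
  | nil => exact mono_id_one.symm
  | cons g l ih =>
    rw [seqOp_cons, ih fun g' h => hl g' (by simp [h]), Gate.toOp_eq_mono (hl g (by simp)),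
      mono_mul_mono]
    rfl

/-- Conjugating by Hadamard gates on `b` a monomial operator that adds `e` to the bit `b` and whose
phase picks up the sign `(-1) ^ q` when the bit `b` is flipped, one gets a monomial operator that
adds `q` to the bit `b`. -/
theorem hadamard_conj_mono {b : Fin k} {π : Basis k → Basis k} {φ : Basis k → ℂ}
    (e q : Basis k → Fin 2)
    (h1 : ∀ y s j, j ≠ b → π (Function.update y b s) j = π y j)
    (h2 : ∀ y, π y b = y b + e y)
    (h3 : ∀ y s, e (Function.update y b s) = e y)
    (h4 : ∀ y, φ (Function.update y b 1) =
      (if q y = 1 then -1 else 1) * φ (Function.update y b 0)) :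
    (Gate.h b).toOp * mono π φ * (Gate.h b).toOp =
      mono (fun y => Function.update (π y) b (y b + q y))
        (fun y => φ (Function.update y b 0) * (if y b + q y = 1 ∧ e y = 1 then -1 else 1)) := by
  ext x y
  simp only [Gate.toOp]
  rw [mul_controlled _ (by simp)]
  simp only [controlled_mul, mono_apply]
  have key : ∀ r s : Fin 2, (Function.update x b r = π (Function.update y b s)) ↔
      ((∀ j, j ≠ b → x j = π y j) ∧ r = s + e y) := by
    intro r s
    constructor
    · intro h
      refine ⟨fun j hj => ?_, ?_⟩
      · have := congrFun h j
        rwa [Function.update_of_ne hj, h1 y s j hj] at this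
      · have := congrFun h b
        rwa [Function.update_self, h2, Function.update_self, h3] at this
    · rintro ⟨ha, hb⟩
      funext j
      by_cases hj : j = b
      · subst hj
        rw [Function.update_self, h2, Function.update_self, h3, hb]
      · rw [Function.update_of_ne hj, h1 y s j hj, ha j hj]
  have key2 : (x = Function.update (π y) b (y b + q y)) ↔
      ((∀ j, j ≠ b → x j = π y j) ∧ x b = y b + q y) := by
    constructor
    · intro h
      exact ⟨fun j hj => by rw [h, Function.update_of_ne hj], by rw [h, Function.update_self]⟩
    · rintro ⟨ha, hb⟩
      funext j
      by_cases hj : j = b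
      · subst hj; rw [Function.update_self, hb]
      · rw [Function.update_of_ne hj, ha j hj]
  simp only [key, key2]
  by_cases ha : ∀ j, j ≠ b → x j = π y j
  · have hs := one_div_sqrt_two_sq
    have hb : ∀ b : Fin 2, b = 0 ∨ b = 1 := by decide
    have h4 := h4 y
    have ha' := eq_true ha
    have h00 := hadamard_apply 0 0
    have h01 := hadamard_apply 0 1
    have h10 := hadamard_apply 1 0
    have h11 := hadamard_apply 1 1
    simp only [ha', true_and, Fin.sum_univ_two]
    generalize ((1 / Real.sqrt 2 : ℝ) : ℂ) = r at hs h00 h01 h10 h11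
    simp only [zero_ne_one, false_and, and_false, and_self, if_true, if_false, mul_one, mul_neg]
      at h00 h01 h10 h11
    generalize φ (Function.update y b 1) = p' at h4 ⊢
    generalize φ (Function.update y b 0) = p at h4 ⊢
    rcases hb (x b) with hx | hx <;> rcases hb (y b) with hy | hy <;>
      rcases hb (e y) with he | he <;> rcases hb (q y) with hq | hq <;>
      simp [hx, hy, he, hq, h00, h01, h10, h11] at h4 ⊢ <;> (try rw [h4]) <;>
      first
        | done
        | ring1
        | linear_combination (2 * p) * hs
        | linear_combination (-2 * p) * hs
  · simp [ha]

/-! ### CNOT sequences along a line -/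

theorem bit_add_add_cancel (a b : Fin 2) : a + b + b = a := by revert a b; decide

theorem Gate.Classical.wf {g : Gate k} (h : g.Classical) : g.WF := by
  cases g <;> first | exact h | trivial

theorem Gate.inv_flow {g : Gate k} (hg : g.Classical) (y : Basis k) :
    g.inv.flow (g.flow y) = y := by
  cases g with
  | cnot c q =>
    have hg : c ≠ q := hg
    simp [Gate.inv, Gate.flow, Function.update_of_ne hg, bit_add_add_cancel]
  | _ => rfl

theorem mem_invGates {l : List (Gate k)} {g : Gate k} (h : g ∈ invGates l) :
    ∃ g' ∈ l, g = g'.inv := by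
  simp only [invGates, List.mem_reverse, List.mem_map] at h
  obtain ⟨g', h1, h2⟩ := h
  exact ⟨g', h1, h2.symm⟩

theorem flowL_invGates {l : List (Gate k)} (hl : ∀ g ∈ l, g.Classical) (y : Basis k) :
    flowL (invGates l) (flowL l y) = y := by
  induction l generalizing y with
  | nil => rfl
  | cons g l ih =>
    rw [invGates_cons, flowL_append]
    change g.inv.flow (flowL (invGates l) (flowL l (g.flow y))) = y
    rw [ih fun g' h => hl g' (by simp [h])]
    exact Gate.inv_flow (hl g (by simp)) y

/-- To invert the flow of `l` at `y`, it is enough to find the state that flows to `y`. -/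
theorem flowL_invGates_eq {l : List (Gate k)} (hl : ∀ g ∈ l, g.Classical) {y z : Basis k}
    (h : flowL l z = y) : flowL (invGates l) y = z := by
  rw [← h, flowL_invGates hl]

theorem phL_cnot {l : List (Gate k)} (hl : ∀ g ∈ l, g.isCNOT = true) (y : Basis k) :
    phL l y = 1 := by
  induction l generalizing y with
  | nil => rfl
  | cons g l ih =>
    rw [phL, ih fun g' h => hl g' (by simp [h])]
    have := hl g (by simp)
    cases g <;> simp_all [Gate.isCNOT, Gate.ph]

theorem flowL_T {l : List (Gate k)} (hl : ∀ g ∈ l, g.isT = true) (y : Basis k) :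
    flowL l y = y := by
  induction l generalizing y with
  | nil => rfl
  | cons g l ih =>
    have := hl g (by simp)
    rw [flowL, ih fun g' h => hl g' (by simp [h])]
    cases g <;> simp_all [Gate.isT, Gate.flow]

/-- Every gate of the list is a CNOT gate on two neighboring qubits. -/
def IsNearCNOTs (l : List (Gate k)) : Prop := ∀ g ∈ l, g.isCNOT = true ∧ g.IsLNN

theorem IsNearCNOTs.classical {l : List (Gate k)} (h : IsNearCNOTs l) :
    ∀ g ∈ l, g.Classical := by
  intro g hg
  obtain ⟨h1, h2⟩ := h g hg
  cases g with
  | cnot c q =>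
    rintro rfl
    simp [Gate.IsLNN] at h2
  | _ => simp [Gate.isCNOT] at h1

theorem IsNearCNOTs.append {l l' : List (Gate k)} (h : IsNearCNOTs l) (h' : IsNearCNOTs l') :
    IsNearCNOTs (l ++ l') := by
  intro g hg
  rcases List.mem_append.mp hg with hg | hg
  exacts [h g hg, h' g hg]

theorem IsNearCNOTs.inv {l : List (Gate k)} (h : IsNearCNOTs l) : IsNearCNOTs (invGates l) := by
  intro g hg
  obtain ⟨g', h1, rfl⟩ := mem_invGates hg
  have := h g' h1
  cases g' <;> simp_all [Gate.isCNOT, Gate.inv, Gate.IsLNN]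

theorem IsNearCNOTs.isCNOT {l : List (Gate k)} (h : IsNearCNOTs l) :
    ∀ g ∈ l, g.isCNOT = true := fun g hg => (h g hg).1

theorem isNearCNOTs_nil : IsNearCNOTs ([] : List (Gate k)) := by simp [IsNearCNOTs]

theorem length_invGates (l : List (Gate k)) : (invGates l).length = l.length := by
  simp [invGates]

/-- An enumeration of the line from one of its two ends. -/
structure IsPath (f : ℕ → Fin k) : Prop where
  inj : ∀ i < k, ∀ j < k, f i = f j → i = j
  adj : ∀ i, i + 1 < k → (f i : ℕ) + 1 = f (i + 1) ∨ (f (i + 1) : ℕ) + 1 = f i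

theorem IsPath.ne {f : ℕ → Fin k} (hf : IsPath f) {i j : ℕ} (hi : i < k) (hj : j < k)
    (h : i ≠ j) : f i ≠ f j := fun e => h (hf.inj i hi j hj e)

/-- The CNOT gates along the path from the position `b` over `p` steps: every qubit is added to
the next one, so that prefix parities accumulate. -/
def ladder (f : ℕ → Fin k) (b p : ℕ) : List (Gate k) :=
  (List.range p).map fun i => .cnot (f (b + i)) (f (b + i + 1))

theorem ladder_succ (f : ℕ → Fin k) (b p : ℕ) :
    ladder f b (p + 1) = ladder f b p ++ [.cnot (f (b + p)) (f (b + p + 1))] := by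
  simp [ladder, List.range_succ]

@[simp] theorem length_ladder (f : ℕ → Fin k) (b p : ℕ) : (ladder f b p).length = p := by
  simp [ladder]

theorem isNearCNOTs_ladder {f : ℕ → Fin k} (hf : IsPath f) {b p : ℕ} (h : b + p < k) :
    IsNearCNOTs (ladder f b p) := by
  intro g hg
  simp only [ladder, List.mem_map, List.mem_range] at hg
  obtain ⟨i, hi, rfl⟩ := hg
  exact ⟨rfl, hf.adj (b + i) (by omega)⟩

theorem flowL_ladder_of_forall_ne (f : ℕ → Fin k) (b p : ℕ) (y : Basis k) {q : Fin k}
    (hq : ∀ j < p, q ≠ f (b + j + 1)) : flowL (ladder f b p) y q = y q := by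
  induction p with
  | zero => rfl
  | succ p ih =>
    rw [ladder_succ, flowL_append]
    simp only [flowL, Gate.flow]
    rw [Function.update_of_ne (hq p (by omega)), ih fun j hj => hq j (by omega)]

theorem flowL_ladder {f : ℕ → Fin k} (hf : IsPath f) {b p : ℕ} (h : b + p < k) (y : Basis k)
    {j : ℕ} (hj : j ≤ p) :
    flowL (ladder f b p) y (f (b + j)) = ∑ i ∈ Finset.range (j + 1), y (f (b + i)) := by
  induction p generalizing j with
  | zero =>
    obtain rfl : j = 0 := by omega
    simp [ladder, flowL]
  | succ p ih =>
    rw [ladder_succ, flowL_append]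
    simp only [flowL, Gate.flow]
    rcases Nat.lt_or_ge p j with hpj | hpj
    · obtain rfl : j = p + 1 := by omega
      rw [← add_assoc, Function.update_self, ih (by omega) le_rfl, Finset.sum_range_succ _ (p + 1),
        flowL_ladder_of_forall_ne, add_comm, ← add_assoc b]
      intro i hi
      exact hf.ne (by omega) (by omega) (by omega)
    · rw [Function.update_of_ne (hf.ne (by omega) (by omega) (by omega)), ih (by omega) hpj]

/-- CNOT gates that add the qubit at the position `p + d + 1` of the path to all the qubits at the
positions `p, …, p + d`. -/
def spread (f : ℕ → Fin k) : ℕ → ℕ → List (Gate k)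
  | p, 0 => [.cnot (f (p + 1)) (f p)]
  | p, d + 1 => .cnot (f (p + 1)) (f p) :: (spread f (p + 1) d ++ [.cnot (f (p + 1)) (f p)])

@[simp] theorem length_spread (f : ℕ → Fin k) (p d : ℕ) :
    (spread f p d).length = 2 * d + 1 := by
  induction d generalizing p with
  | zero => rfl
  | succ d ih => simp [spread, ih]; ring

theorem isNearCNOTs_spread {f : ℕ → Fin k} (hf : IsPath f) {p d : ℕ} (h : p + d + 1 < k) :
    IsNearCNOTs (spread f p d) := by
  have h1 : ∀ p, p + 1 < k → IsNearCNOTs [.cnot (f (p + 1)) (f p)] := by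
    intro p hp g hg
    simp only [List.mem_singleton] at hg
    subst hg
    exact ⟨rfl, (hf.adj p hp).symm⟩
  induction d generalizing p with
  | zero => exact h1 p (by omega)
  | succ d ih =>
    exact (h1 p (by omega)).append ((ih (by omega)).append (h1 p (by omega)))

theorem flowL_spread_of_forall_ne (f : ℕ → Fin k) (p d : ℕ) (y : Basis k) {q : Fin k}
    (hq : ∀ j ≤ d, q ≠ f (p + j)) : flowL (spread f p d) y q = y q := by
  induction d generalizing p y with
  | zero =>
    simp only [spread, flowL, Gate.flow]
    rw [Function.update_of_ne (by simpa using hq 0 le_rfl)]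
  | succ d ih =>
    have h0 : q ≠ f p := by simpa using hq 0 (by omega)
    simp only [spread, flowL, flowL_append, Gate.flow]
    rw [Function.update_of_ne h0, ih, Function.update_of_ne h0]
    intro j hj
    rw [show p + 1 + j = p + (j + 1) by omega]
    exact hq _ (by omega)

theorem flowL_spread {f : ℕ → Fin k} (hf : IsPath f) {p d : ℕ} (h : p + d + 1 < k) (y : Basis k)
    {j : ℕ} (hj : j ≤ d) :
    flowL (spread f p d) y (f (p + j)) = y (f (p + j)) + y (f (p + d + 1)) := by
  induction d generalizing p y j with
  | zero =>
    obtain rfl : j = 0 := by omega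
    simp [spread, flowL, Gate.flow]
  | succ d ih =>
    simp only [spread, flowL, flowL_append, Gate.flow]
    have e : p + 1 + d + 1 = p + (d + 1) + 1 := by omega
    have hne : ∀ i, i + p < k → 0 < i → f (p + i) ≠ f p := fun i h1 h2 =>
      hf.ne (by omega) (by omega) (by omega)
    rcases Nat.eq_zero_or_pos j with rfl | hj0
    · rw [add_zero, Function.update_self, flowL_spread_of_forall_ne, Function.update_self]
      · have := ih (p := p + 1) (by omega)
          (Function.update y (f p) (y (f p) + y (f (p + 1)))) (Nat.zero_le d)
        rw [add_zero] at this
        rw [this, e, Function.update_of_ne (hne 1 (by omega) (by omega)), add_assoc p,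
          Function.update_of_ne (hne (d + 1 + 1) (by omega) (by omega))]
        generalize y (f (p + 1)) = u
        generalize y (f p) = v
        generalize y (f (p + (d + 1 + 1))) = w
        revert u v w
        decide
      · intro j hj
        exact hf.ne (by omega) (by omega) (by omega)
    · obtain ⟨j, rfl⟩ : ∃ i, j = i + 1 := ⟨j - 1, by omega⟩
      rw [Function.update_of_ne (hne _ (by omega) (by omega)),
        show p + (j + 1) = p + 1 + j by omega, ih (by omega) _ (by omega), e,
        show p + 1 + j = p + (j + 1) by omega, 
        Function.update_of_ne (hne _ (by omega) (by omega)), add_assoc p,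
        Function.update_of_ne (hne _ (by omega) (by omega))]

/-- CNOT gates that add to the qubit at the position `p` of the path all the qubits before it. -/
def sumInto (f : ℕ → Fin k) (p : ℕ) : List (Gate k) :=
  ladder f 0 p ++ invGates (ladder f 0 (p - 1))

theorem isNearCNOTs_sumInto {f : ℕ → Fin k} (hf : IsPath f) {p : ℕ} (h : p < k) :
    IsNearCNOTs (sumInto f p) :=
  (isNearCNOTs_ladder hf (by omega)).append (isNearCNOTs_ladder hf (by omega)).inv

theorem flowL_sumInto {f : ℕ → Fin k} (hf : IsPath f) {p : ℕ} (h : p < k) (y : Basis k) :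
    flowL (sumInto f p) y =
      Function.update y (f p) (y (f p) + ∑ i ∈ Finset.range p, y (f i)) := by
  rw [sumInto, flowL_append]
  apply flowL_invGates_eq (isNearCNOTs_ladder hf (by omega)).classical
  rcases Nat.eq_zero_or_pos p with rfl | hp
  · simp [ladder, flowL]
  obtain ⟨p, rfl⟩ : ∃ i, p = i + 1 := ⟨p - 1, by omega⟩
  rw [ladder_succ, flowL_append, Nat.add_sub_cancel]
  simp only [flowL, Gate.flow]
  have hl := flowL_ladder hf (b := 0) (p := p) (by omega)
  simp only [zero_add] at hl ⊢
  funext q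
  have hn : ∀ z : Basis k, flowL (ladder f 0 p) z (f (p + 1)) = z (f (p + 1)) := by
    intro z
    apply flowL_ladder_of_forall_ne
    intro j hj
    exact hf.ne (by omega) (by omega) (by omega)
  by_cases hq : q = f (p + 1)
  · subst hq
    rw [hn, Function.update_self, Function.update_self, hn, hl y le_rfl]
  rw [Function.update_of_ne hq]
  by_cases hq' : ∃ j ≤ p, q = f j
  · obtain ⟨j, hj, rfl⟩ := hq'
    rw [hl _ hj, hl _ hj]
    refine Finset.sum_congr rfl fun i hi => ?_
    rw [Finset.mem_range] at hi
    rw [Function.update_of_ne (hf.ne (by omega) (by omega) (by omega))]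
  · push Not at hq'
    rw [flowL_ladder_of_forall_ne, flowL_ladder_of_forall_ne, Function.update_of_ne hq]
    all_goals
      intro j hj
      rw [zero_add]
      exact hq' _ (by omega)

/-- The basis state with the bit `t` flipped. -/
def flip (t : Fin k) (y : Basis k) : Basis k := Function.update y t (y t + 1)

theorem flip_self (t : Fin k) (y : Basis k) : flip t y t = y t + 1 := Function.update_self ..

theorem flip_of_ne {t q : Fin k} (h : q ≠ t) (y : Basis k) : flip t y q = y q :=
  Function.update_of_ne h ..

theorem sum_flip_of_mem {f : ℕ → Fin k} (hf : IsPath f) {b p i : ℕ} (h : b + p ≤ k) (hi : i < p)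
    (y : Basis k) :
    ∑ j ∈ Finset.range p, flip (f (b + i)) y (f (b + j)) =
      ∑ j ∈ Finset.range p, y (f (b + j)) + 1 := by
  have hi' : i ∈ Finset.range p := Finset.mem_range.mpr hi
  rw [← Finset.add_sum_erase _ _ hi', ← Finset.add_sum_erase _ (fun j => y (f (b + j))) hi',
    flip_self]
  have : ∑ j ∈ (Finset.range p).erase i, flip (f (b + i)) y (f (b + j)) =
      ∑ j ∈ (Finset.range p).erase i, y (f (b + j)) := by
    refine Finset.sum_congr rfl fun j hj => flip_of_ne ?_ y
    rw [Finset.mem_erase, Finset.mem_range] at hj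
    exact hf.ne (by omega) (by omega) (by omega)
  rw [this]
  abel

theorem sum_flip_of_notMem (f : ℕ → Fin k) {b p : ℕ} {t : Fin k}
    (ht : ∀ i < p, f (b + i) ≠ t) (y : Basis k) :
    ∑ j ∈ Finset.range p, flip t y (f (b + j)) = ∑ j ∈ Finset.range p, y (f (b + j)) :=
  Finset.sum_congr rfl fun j hj => flip_of_ne (ht j (Finset.mem_range.mp hj)) y

/-- The line enumerated from the left. -/
def fromLeft [NeZero k] (i : ℕ) : Fin k := Fin.ofNat k i

/-- The line enumerated from the right. -/
def fromRight [NeZero k] (i : ℕ) : Fin k := Fin.ofNat k (k - 1 - i)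

theorem val_fromLeft [NeZero k] {i : ℕ} (h : i < k) : (fromLeft i : Fin k).val = i :=
  Nat.mod_eq_of_lt h

theorem val_fromRight [NeZero k] (i : ℕ) : (fromRight i : Fin k).val = k - 1 - i :=
  Nat.mod_eq_of_lt (by have := NeZero.pos k; omega)

theorem fromLeft_val [NeZero k] (q : Fin k) : fromLeft q.val = q :=
  Fin.ext (val_fromLeft q.isLt)

theorem isPath_fromLeft [NeZero k] : IsPath (fromLeft : ℕ → Fin k) where
  inj i hi j hj h := by
    have := congrArg Fin.val h
    rwa [val_fromLeft hi, val_fromLeft hj] at this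
  adj i hi := by
    left
    rw [val_fromLeft hi, val_fromLeft (by omega)]

theorem isPath_fromRight [NeZero k] : IsPath (fromRight : ℕ → Fin k) where
  inj i hi j hj h := by
    have := congrArg Fin.val h
    rw [val_fromRight, val_fromRight] at this
    omega
  adj i hi := by
    right
    rw [val_fromRight, val_fromRight]
    omega

/-! ### Factorization of special unitary matrices of size two -/

/-- The unit quaternion with coordinates `(w₀, w₁, w₂, w₃)` as the matrix
`w₀ - i (w₁ X + w₂ Y + w₃ Z)`. -/
noncomputable def quat (w₀ w₁ w₂ w₃ : ℝ) : Matrix (Fin 2) (Fin 2) ℂ :=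
  !![w₀ - Complex.I * w₃, -Complex.I * w₁ - w₂;
     -Complex.I * w₁ + w₂, w₀ + Complex.I * w₃]

theorem quat_mul (a₀ a₁ a₂ a₃ b₀ b₁ b₂ b₃ : ℝ) :
    quat a₀ a₁ a₂ a₃ * quat b₀ b₁ b₂ b₃ =
      quat (a₀ * b₀ - a₁ * b₁ - a₂ * b₂ - a₃ * b₃) (a₀ * b₁ + a₁ * b₀ + a₂ * b₃ - a₃ * b₂)
        (a₀ * b₂ - a₁ * b₃ + a₂ * b₀ + a₃ * b₁) (a₀ * b₃ + a₁ * b₂ - a₂ * b₁ + a₃ * b₀) := by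
  have hI := Complex.I_mul_I
  unfold quat
  ext i j
  fin_cases i <;> fin_cases j <;> simp [Matrix.mul_apply, Fin.sum_univ_two]
  · linear_combination ((a₃ : ℂ) * b₃ + a₁ * b₁) * hI
  · linear_combination ((a₃ : ℂ) * b₁ - a₁ * b₃) * hI
  · linear_combination ((a₁ : ℂ) * b₃ - a₃ * b₁) * hI
  · linear_combination ((a₃ : ℂ) * b₃ + a₁ * b₁) * hI

theorem rotX_eq_quat (θ : ℝ) : rotX θ = quat (Real.cos (θ / 2)) (Real.sin (θ / 2)) 0 0 := by
  unfold rotX quat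
  ext i j
  fin_cases i <;> fin_cases j <;> simp

theorem rotZ_eq_quat (θ : ℝ) : rotZ θ = quat (Real.cos (θ / 2)) 0 0 (Real.sin (θ / 2)) := by
  have e1 : Complex.exp (Complex.I * (θ / 2 : ℝ)) =
      Real.cos (θ / 2) + Complex.I * Real.sin (θ / 2) := by
    rw [mul_comm, Complex.exp_mul_I, ← Complex.ofReal_cos, ← Complex.ofReal_sin]
    ring
  have e2 : Complex.exp (-(Complex.I * (θ / 2 : ℝ))) =
      Real.cos (θ / 2) - Complex.I * Real.sin (θ / 2) := by
    rw [← mul_neg, mul_comm, ← Complex.ofReal_neg, Complex.exp_mul_I, ← Complex.ofReal_cos,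
      ← Complex.ofReal_sin, Real.cos_neg, Real.sin_neg]
    push_cast
    ring
  unfold rotZ quat
  rw [e1, e2]
  ext i j
  fin_cases i <;> fin_cases j <;> simp

theorem rotZ_conj_rotX (c θ : ℝ) :
    rotZ c * rotX θ * rotZ (-c) =
      quat (Real.cos (θ / 2)) (Real.sin (θ / 2) * Real.cos c) (Real.sin (θ / 2) * Real.sin c) 0 := by
  have hc : Real.cos c = Real.cos (c / 2) ^ 2 - Real.sin (c / 2) ^ 2 := by
    rw [← Real.cos_two_mul', mul_div_cancel₀ c two_ne_zero]
  have hs : Real.sin c = 2 * Real.sin (c / 2) * Real.cos (c / 2) := by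
    rw [← Real.sin_two_mul, mul_div_cancel₀ c two_ne_zero]
  have h1 := Real.sin_sq_add_cos_sq (c / 2)
  rw [rotZ_eq_quat, rotZ_eq_quat, rotX_eq_quat, quat_mul, quat_mul, hc, hs, neg_div, Real.cos_neg,
    Real.sin_neg]
  congr 1
  · linear_combination Real.cos (θ / 2) * h1
  · ring
  · ring
  · ring

theorem rotX_conj_quat (b w₀ w₁ w₂ w₃ : ℝ) :
    rotX b * quat w₀ w₁ w₂ w₃ * rotX (-b) =
      quat w₀ w₁ (w₂ * Real.cos b - w₃ * Real.sin b) (w₂ * Real.sin b + w₃ * Real.cos b) := by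
  have hc : Real.cos b = Real.cos (b / 2) ^ 2 - Real.sin (b / 2) ^ 2 := by
    rw [← Real.cos_two_mul', mul_div_cancel₀ b two_ne_zero]
  have hs : Real.sin b = 2 * Real.sin (b / 2) * Real.cos (b / 2) := by
    rw [← Real.sin_two_mul, mul_div_cancel₀ b two_ne_zero]
  have h1 := Real.sin_sq_add_cos_sq (b / 2)
  rw [rotX_eq_quat, rotX_eq_quat, quat_mul, quat_mul, hc, hs, neg_div, Real.cos_neg, Real.sin_neg]
  congr 1
  · linear_combination w₀ * h1
  · linear_combination w₁ * h1
  · ring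
  · ring

theorem exists_polar (a b : ℝ) :
    ∃ r φ : ℝ, a = r * Real.cos φ ∧ b = r * Real.sin φ ∧ r ^ 2 = a ^ 2 + b ^ 2 ∧ 0 ≤ r := by
  refine ⟨‖(⟨a, b⟩ : ℂ)‖, Complex.arg ⟨a, b⟩, ?_, ?_, ?_, norm_nonneg _⟩
  · rw [Complex.norm_mul_cos_arg]
  · rw [Complex.norm_mul_sin_arg]
  · rw [← Complex.normSq_eq_norm_sq, Complex.normSq_mk]
    ring

theorem exists_quat_of_mem_specialUnitaryGroup {W : Matrix (Fin 2) (Fin 2) ℂ}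
    (hW : W ∈ Matrix.specialUnitaryGroup (Fin 2) ℂ) :
    ∃ w₀ w₁ w₂ w₃ : ℝ, W = quat w₀ w₁ w₂ w₃ ∧ w₀ ^ 2 + w₁ ^ 2 + w₂ ^ 2 + w₃ ^ 2 = 1 := by
  rw [Matrix.mem_specialUnitaryGroup_iff, Matrix.mem_unitaryGroup_iff'] at hW
  obtain ⟨hu, hd⟩ := hW
  have hadj : star W = W.adjugate := by
    have h1 : W * W.adjugate = 1 := by rw [Matrix.mul_adjugate, hd, one_smul]
    calc star W = star W * (W * W.adjugate) := by rw [h1, mul_one]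
      _ = W.adjugate := by rw [← mul_assoc, hu, one_mul]
  have h00 := congrFun (congrFun hadj 0) 0
  have h01 := congrFun (congrFun hadj 0) 1
  rw [Matrix.adjugate_fin_two] at h00 h01
  simp only [Matrix.star_apply, Matrix.of_apply, Matrix.cons_val', Matrix.cons_val_zero,
    Matrix.cons_val_one, Matrix.cons_val_fin_one] at h00 h01
  rw [Matrix.det_fin_two] at hd
  refine ⟨(W 0 0).re, -(W 1 0).im, (W 1 0).re, -(W 0 0).im, ?_, ?_⟩
  · have e01 : W 0 1 = -star (W 1 0) := by rw [h01, neg_neg]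
    unfold quat
    ext i j
    fin_cases i <;> fin_cases j <;> simp
    · apply Complex.ext <;> simp
    · rw [e01]; apply Complex.ext <;> simp
    · apply Complex.ext <;> simp
    · rw [← h00]; apply Complex.ext <;> simp
  · have e01 : W 0 1 = -star (W 1 0) := by rw [h01, neg_neg]
    rw [← h00, e01] at hd
    have := congrArg Complex.re hd
    simp at this
    linarith

theorem exists_eq_rotations {W : Matrix (Fin 2) (Fin 2) ℂ}
    (hW : W ∈ Matrix.specialUnitaryGroup (Fin 2) ℂ) :
    ∃ b c θ : ℝ, W = rotX b * rotZ c * rotX θ * rotZ (-c) * rotX (-b) := by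
  obtain ⟨w₀, w₁, w₂, w₃, rfl, hw⟩ := exists_quat_of_mem_specialUnitaryGroup hW
  obtain ⟨r, b, h2, h3, hr, -⟩ := exists_polar w₂ w₃
  obtain ⟨s, c, h1, h4, hs, -⟩ := exists_polar w₁ r
  obtain ⟨ρ, φ, h5, h6, hρ, hρ0⟩ := exists_polar w₀ s
  have h7 : ρ = 1 := by nlinarith
  rw [h7, one_mul] at h5 h6
  refine ⟨b, c, 2 * φ, ?_⟩
  have e := rotZ_conj_rotX c (2 * φ)
  rw [mul_div_cancel_left₀ φ two_ne_zero, ← h5, ← h6, ← h1, ← h4] at e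
  calc quat w₀ w₁ w₂ w₃ = rotX b * quat w₀ w₁ r 0 * rotX (-b) := by
        rw [rotX_conj_quat, h2, h3]
        congr 1 <;> ring
    _ = _ := by rw [← e]; simp only [mul_assoc]

/-- The Pauli `Z` matrix. -/
def pauliZ : Matrix (Fin 2) (Fin 2) ℂ := !![1, 0; 0, -1]

theorem pauliZ_mul_self : pauliZ * pauliZ = 1 := by
  ext i j
  fin_cases i <;> fin_cases j <;> simp [pauliZ]

theorem pauliZ_conj_rotX (θ : ℝ) : pauliZ * rotX θ * pauliZ = rotX (-θ) := by
  unfold rotX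
  rw [neg_div, Real.cos_neg, Real.sin_neg]
  ext i j
  fin_cases i <;> fin_cases j <;> simp [pauliZ, Matrix.mul_apply, Fin.sum_univ_two]

/-- The single-qubit commutators that yield `rotX (-4 * β)`. -/
theorem pauliZ_rotX_commutator (β : ℝ) :
    pauliZ * rotX β * pauliZ * rotX (-β) * pauliZ * rotX β * pauliZ * rotX (-β) =
      rotX (-4 * β) := by
  calc _ = pauliZ * rotX β * pauliZ * rotX (-β) * (pauliZ * rotX β * pauliZ) * rotX (-β) := by
        simp only [mul_assoc]
    _ = _ := by
        rw [pauliZ_conj_rotX, rotX_mul, rotX_mul, rotX_mul]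
        congr 1
        ring

/-! ### Operators that are block diagonal with product blocks -/

/-- The basis state with the bits in `T` set to `0`. -/
def zeroOn (T : Finset (Fin k)) (y : Basis k) : Basis k := fun i => if i ∈ T then 0 else y i

theorem zeroOn_of_mem {T : Finset (Fin k)} {i : Fin k} (h : i ∈ T) (y : Basis k) :
    zeroOn T y i = 0 := if_pos h

theorem zeroOn_of_notMem {T : Finset (Fin k)} {i : Fin k} (h : i ∉ T) (y : Basis k) :
    zeroOn T y i = y i := if_neg h

/-- The operator that, for each state `r` of the qubits outside of `T`, acts on the qubits of `T`
by `s r` times the tensor product of the matrices `F r i`. -/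
noncomputable def blockOp (T : Finset (Fin k)) (s : Basis k → ℂ)
    (F : Basis k → Fin k → Matrix (Fin 2) (Fin 2) ℂ) : Op k :=
  Matrix.of fun x y =>
    s (zeroOn T y) * ∏ i, (if i ∈ T then F (zeroOn T y) i else 1) (x i) (y i)

theorem blockOp_apply (T : Finset (Fin k)) (s : Basis k → ℂ)
    (F : Basis k → Fin k → Matrix (Fin 2) (Fin 2) ℂ) (x y : Basis k) :
    blockOp T s F x y =
      s (zeroOn T y) * ∏ i, (if i ∈ T then F (zeroOn T y) i else 1) (x i) (y i) := rfl

theorem blockOp_mul (T : Finset (Fin k)) (s s' : Basis k → ℂ)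
    (F F' : Basis k → Fin k → Matrix (Fin 2) (Fin 2) ℂ) :
    blockOp T s F * blockOp T s' F' = blockOp T (fun r => s r * s' r) fun r i => F r i * F' r i := by
  ext x y
  rw [Matrix.mul_apply]
  have key : ∀ z, blockOp T s F x z * blockOp T s' F' z y =
      (s (zeroOn T y) * s' (zeroOn T y)) *
        ∏ i, (if i ∈ T then F (zeroOn T y) i else 1) (x i) (z i) *
          (if i ∈ T then F' (zeroOn T y) i else 1) (z i) (y i) := by
    intro z
    rw [blockOp_apply, blockOp_apply, Finset.prod_mul_distrib]
    by_cases h : zeroOn T z = zeroOn T y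
    · rw [h]; ring
    · have : ∏ i, (if i ∈ T then F' (zeroOn T y) i else 1) (z i) (y i) = 0 := by
        obtain ⟨i, hi⟩ := Function.ne_iff.mp h
        have hT : i ∉ T := fun hT => hi (by rw [zeroOn_of_mem hT, zeroOn_of_mem hT])
        rw [zeroOn_of_notMem hT, zeroOn_of_notMem hT] at hi
        exact Finset.prod_eq_zero (Finset.mem_univ i) (by rw [if_neg hT, Matrix.one_apply_ne hi])
      rw [this]; ring
  simp only [key]
  rw [← Finset.mul_sum, blockOp_apply]
  congr 1
  rw [← Fintype.piFinset_univ, ← Finset.prod_univ_sum (fun _ => Finset.univ) fun i b =>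
    (if i ∈ T then F (zeroOn T y) i else 1) (x i) b *
          (if i ∈ T then F' (zeroOn T y) i else 1) b (y i)]
  refine Finset.prod_congr rfl fun i _ => ?_
  rw [← Matrix.mul_apply]
  split_ifs
  · rfl
  · rw [one_mul]

theorem blockOp_congr {T : Finset (Fin k)} {s s' : Basis k → ℂ}
    {F F' : Basis k → Fin k → Matrix (Fin 2) (Fin 2) ℂ} (hs : ∀ r, s r = s' r)
    (hF : ∀ r, ∀ i ∈ T, F r i = F' r i) : blockOp T s F = blockOp T s' F' := by
  ext x y
  rw [blockOp_apply, blockOp_apply, hs]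
  congr 1
  refine Finset.prod_congr rfl fun i _ => ?_
  split_ifs with h
  · rw [hF _ i h]
  · rfl

theorem prod_one_apply (x y : Basis k) :
    ∏ i, (1 : Matrix (Fin 2) (Fin 2) ℂ) (x i) (y i) = if x = y then 1 else 0 := by
  split_ifs with h
  · subst h; simp
  · obtain ⟨i, hi⟩ := Function.ne_iff.mp h
    exact Finset.prod_eq_zero (Finset.mem_univ i) (Matrix.one_apply_ne hi)

theorem blockOp_one (T : Finset (Fin k)) : blockOp T (fun _ => 1) (fun _ _ => 1) = 1 := by
  ext x y
  rw [blockOp_apply]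
  simp only [ite_self, one_mul]
  rw [prod_one_apply, Matrix.one_apply]

open Classical in
theorem controlled_eq_blockOp {T C : Finset (Fin k)} {t : Fin k} (ht : t ∈ T)
    (hC : Disjoint C T) (U : Matrix (Fin 2) (Fin 2) ℂ) :
    controlled C t U = blockOp T (fun _ => 1)
      fun r i => if i = t ∧ ∀ c ∈ C, r c = 1 then U else 1 := by
  ext x y
  rw [blockOp_apply, one_mul]
  have hc : (∀ c ∈ C, zeroOn T y c = 1) ↔ ∀ c ∈ C, y c = 1 := by
    refine forall₂_congr fun c hc => ?_
    rw [zeroOn_of_notMem (Finset.disjoint_left.mp hC hc)]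
  rw [← Finset.mul_prod_erase _ _ (Finset.mem_univ t), if_pos ht]
  simp only [hc, true_and]
  have hrest : ∏ i ∈ Finset.univ.erase t,
      (if i ∈ T then (if i = t ∧ ∀ c ∈ C, y c = 1 then U else 1) else 1 :
        Matrix (Fin 2) (Fin 2) ℂ) (x i) (y i) = if ∀ j, j ≠ t → x j = y j then 1 else 0 := by
    have : ∀ i ∈ Finset.univ.erase t,
      (if i ∈ T then (if i = t ∧ ∀ c ∈ C, y c = 1 then U else 1) else 1 :
        Matrix (Fin 2) (Fin 2) ℂ) (x i) (y i) = (1 : Matrix (Fin 2) (Fin 2) ℂ) (x i) (y i) := by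
      intro i hi
      simp [Finset.ne_of_mem_erase hi]
    rw [Finset.prod_congr rfl this]
    split_ifs with h
    · exact Finset.prod_eq_one fun i hi => by
        rw [h i (Finset.ne_of_mem_erase hi), Matrix.one_apply_eq]
    · push Not at h
      obtain ⟨i, hi, hne⟩ := h
      exact Finset.prod_eq_zero (Finset.mem_erase.mpr ⟨hi, Finset.mem_univ i⟩)
        (Matrix.one_apply_ne hne)
  rw [hrest, controlled, Matrix.of_apply]
  by_cases h1 : ∀ j, j ≠ t → x j = y j
  · rw [if_pos h1, if_pos h1, mul_one]
    split_ifs <;> rfl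
  · rw [if_neg h1, if_neg h1, mul_zero]

open Classical in
theorem prod_controlled_eq_blockOp {T C : Finset (Fin k)} (hC : Disjoint C T)
    (V : Fin k → Matrix (Fin 2) (Fin 2) ℂ) {L : List (Fin k)} (hL : L.Nodup)
    (hT : ∀ t ∈ L, t ∈ T) :
    (L.map fun t => controlled C t (V t)).prod = blockOp T (fun _ => 1)
      fun r i => if i ∈ L ∧ ∀ c ∈ C, r c = 1 then V i else 1 := by
  induction L with
  | nil => simp [blockOp_one]
  | cons t L ih =>
    rw [List.nodup_cons] at hL
    rw [List.map_cons, List.prod_cons, ih hL.2 fun t' h => hT t' (by simp [h]),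
      controlled_eq_blockOp (hT t (by simp)) hC, blockOp_mul]
    refine blockOp_congr (by simp) fun r i _ => ?_
    by_cases hr : ∀ c ∈ C, r c = 1
    · by_cases hi : i = t
      · subst hi
        simp [hL.1]
      · simp [hi]
    · simp [hr]

/-- A layer of gates on the distinct qubits of the list `L`. -/
theorem seqOp_layer {T : Finset (Fin k)} {g : Fin k → Gate k}
    {V : Fin k → Matrix (Fin 2) (Fin 2) ℂ} (hg : ∀ t, (g t).toOp = controlled ∅ t (V t))
    {L : List (Fin k)} (hL : L.Nodup) (hT : ∀ t, t ∈ L ↔ t ∈ T) :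
    seqOp (L.map g) = blockOp T (fun _ => 1) fun _ i => V i := by
  classical
  have h : seqOp (L.map g) = (L.reverse.map fun t => controlled ∅ t (V t)).prod := by
    clear hL hT
    induction L with
    | nil => rfl
    | cons t L ih => simp [ih, hg]
  rw [h, prod_controlled_eq_blockOp (T := T) (by simp) V (List.nodup_reverse.mpr hL)
    (by simp [hT])]
  refine blockOp_congr (fun _ => rfl) fun r i hi => ?_
  simp [hT, hi]

/-- A diagonal operator whose phase picks up the sign `(-1) ^ p` whenever a bit of `T` is flipped
acts on the qubits of `T` by Pauli `Z` matrices. -/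
theorem diagonal_eq_blockOp {T : Finset (Fin k)} {α : Basis k → ℂ} {p : Basis k → Prop}
    [DecidablePred p] (hp : ∀ t ∈ T, ∀ y, p (flip t y) ↔ p y)
    (hα : ∀ t ∈ T, ∀ y, α (flip t y) = (if p y then -1 else 1) * α y) :
    mono id α = blockOp T α fun r _ => if p r then pauliZ else 1 := by
  have key : ∀ S ⊆ T, ∀ y, (p (zeroOn S y) ↔ p y) ∧
      α y = α (zeroOn S y) * ∏ i ∈ S, if p y ∧ y i = 1 then -1 else 1 := by
    intro S
    induction S using Finset.induction_on with
    | empty =>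
      intro _ y
      have : zeroOn ∅ y = y := by funext i; simp [zeroOn]
      simp [this]
    | insert t S ht ih =>
      intro hS y
      have htT : t ∈ T := hS (Finset.mem_insert_self _ _)
      obtain ⟨ih1, ih2⟩ := ih ((Finset.subset_insert _ _).trans hS) y
      rw [Finset.prod_insert ht]
      have hb : ∀ b : Fin 2, b = 0 ∨ b = 1 := by decide
      rcases hb (y t) with h | h
      · have e : zeroOn (insert t S) y = zeroOn S y := by
          funext i
          by_cases hi : i = t
          · subst hi; simp [zeroOn, ht, h]
          · simp [zeroOn, hi]
        rw [e]
        exact ⟨ih1, by rw [ih2]; simp [h]⟩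
      · have e : zeroOn (insert t S) y = flip t (zeroOn S y) := by
          funext i
          by_cases hi : i = t
          · subst hi; simp [flip_self, zeroOn, ht, h]
          · simp [zeroOn, hi, flip_of_ne hi]
        rw [e]
        refine ⟨(hp t htT _).trans ih1, ?_⟩
        rw [hα t htT, ih2]
        by_cases hpy : p y
        · simp [ih1, hpy, h]
        · simp [ih1, hpy]
  ext x y
  obtain ⟨k1, k2⟩ := key T subset_rfl y
  rw [mono_apply, blockOp_apply]
  simp only [k1]
  by_cases hxy : x = y
  · subst hxy
    simp only [id, if_true]
    rw [k2, ← Finset.prod_subset (Finset.subset_univ T)]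
    · congr 1
      refine Finset.prod_congr rfl fun i hi => ?_
      rw [if_pos hi]
      have hb : ∀ b : Fin 2, b = 0 ∨ b = 1 := by decide
      rcases hb (x i) with h | h <;> by_cases hpx : p x <;> simp [h, hpx, pauliZ]
    · intro i _ hi
      rw [if_neg hi, Matrix.one_apply_eq]
  · obtain ⟨i, hi⟩ := Function.ne_iff.mp hxy
    rw [if_neg (show ¬ x = id y from hxy), Finset.prod_eq_zero (Finset.mem_univ i), mul_zero]
    have hd : ∀ a b : Fin 2, a ≠ b → pauliZ a b = 0 := by
      intro a b hab
      fin_cases a <;> fin_cases b <;> simp_all [pauliZ]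
    split_ifs
    · exact hd _ _ hi
    · exact Matrix.one_apply_ne hi
    · exact Matrix.one_apply_ne hi

/-! ### The relative-phase doubly controlled gadget -/

/-- A `T` gate (for `true`) or its inverse (for `false`). -/
def tGate (s : Bool) (q : Fin k) : Gate k := if s then .t q else .tdg q

theorem tGate_isT (s : Bool) (q : Fin k) : (tGate s q).isT = true := by cases s <;> rfl

theorem tGate_classical (s : Bool) (q : Fin k) : (tGate s q).Classical := by cases s <;> trivial

theorem tGate_ph (s : Bool) (q : Fin k) (y : Basis k) : (tGate s q).ph y = tPhase s (y q) := by
  cases s <;> rfl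

theorem tGate_qubits (s : Bool) (q : Fin k) : (tGate s q).qubits = {q} := by cases s <;> rfl

/-- The phase that the four `T` gates of the gadget attach to a state with parity `u`, control
bits `v` and `w`, and firing values `κ` and `κ'` of the controls. -/
noncomputable def fourPhase (κ κ' u v w : Fin 2) : ℂ :=
  tPhase true u * tPhase (decide (κ = 0)) (u + v) *
    (tPhase (decide (κ' = 0)) (u + w) * tPhase (decide (κ = κ')) (u + v + w))

/-- The eighth roots of unity attached by the `T` gates combine to a sign that depends on the
parity `u` exactly if both controls have their firing values. -/
theorem fourPhase_add_one (κ κ' u v w : Fin 2) :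
    fourPhase κ κ' (u + 1) v w =
      (if v = κ ∧ w = κ' then -1 else 1) * fourPhase κ κ' u v w := by
  obtain ⟨ω, ω', h1, h2, h3⟩ : ∃ ω ω' : ℂ, ω * ω' = 1 ∧ ω ^ 4 = -1 ∧
      ∀ s b, tPhase s b = if b = 1 then (if s then ω else ω') else 1 := by
    refine ⟨Complex.exp (Complex.I * (Real.pi / 4 : ℝ)),
      Complex.exp (Complex.I * (-(Real.pi / 4) : ℝ)), ?_, ?_, ?_⟩
    · rw [← Complex.exp_add, ← mul_add, ← Complex.ofReal_add, add_neg_cancel]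
      simp
    · rw [← Complex.exp_nat_mul, ← Complex.exp_pi_mul_I]
      congr 1
      push_cast
      ring
    · intro s b
      cases s <;> simp [tPhase]
  have h4 : ω' = -ω ^ 3 := by linear_combination (-ω ^ 3) * h1 + ω' * h2
  have hb : ∀ b : Fin 2, b = 0 ∨ b = 1 := by decide
  have h11 : (1 : Fin 2) + 1 = 0 := rfl
  simp only [fourPhase, h3]
  rcases hb κ with rfl | rfl <;> rcases hb κ' with rfl | rfl <;> rcases hb u with rfl | rfl <;>
    rcases hb v with rfl | rfl <;> rcases hb w with rfl | rfl <;> simp [h11, h4] <;>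
    first
      | done
      | ring1
      | linear_combination h2
      | linear_combination -h2
      | linear_combination ω ^ 2 * h2
      | linear_combination -ω ^ 2 * h2
      | linear_combination (ω ^ 4 - 1) * h2
      | linear_combination (1 - ω ^ 4) * h2

/-- The first time slot of `T` gates of the gadget with its first control at `p + 1`. -/
def tSlot₁ (f : ℕ → Fin k) (p : ℕ) (κ : Fin 2) : List (Gate k) :=
  [tGate true (f p), tGate (decide (κ = 0)) (f (p + 1))]

/-- The second time slot of `T` gates of the gadget with its first control at `p + 1`. -/
def tSlot₂ (f : ℕ → Fin k) (p : ℕ) (κ κ' : Fin 2) : List (Gate k) :=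
  [tGate (decide (κ' = 0)) (f p), tGate (decide (κ = κ')) (f (p + 1))]

theorem isT_tSlot₁ (f : ℕ → Fin k) (p : ℕ) (κ : Fin 2) : ∀ g ∈ tSlot₁ f p κ, g.isT = true := by
  simp [tSlot₁, tGate_isT]

theorem isT_tSlot₂ (f : ℕ → Fin k) (p : ℕ) (κ κ' : Fin 2) :
    ∀ g ∈ tSlot₂ f p κ κ', g.isT = true := by
  simp [tSlot₂, tGate_isT]

theorem classical_tSlot₁ (f : ℕ → Fin k) (p : ℕ) (κ : Fin 2) :
    ∀ g ∈ tSlot₁ f p κ, g.Classical := by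
  simp [tSlot₁, tGate_classical]

theorem classical_tSlot₂ (f : ℕ → Fin k) (p : ℕ) (κ κ' : Fin 2) :
    ∀ g ∈ tSlot₂ f p κ κ', g.Classical := by
  simp [tSlot₂, tGate_classical]

theorem phL_tSlot₁ (f : ℕ → Fin k) (p : ℕ) (κ : Fin 2) (y : Basis k) :
    phL (tSlot₁ f p κ) y = tPhase true (y (f p)) * tPhase (decide (κ = 0)) (y (f (p + 1))) := by
  have h : (tGate true (f p)).flow y = y := rfl
  simp [tSlot₁, phL, tGate_ph, h, mul_comm]

theorem phL_tSlot₂ (f : ℕ → Fin k) (p : ℕ) (κ κ' : Fin 2) (y : Basis k) :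
    phL (tSlot₂ f p κ κ') y =
      tPhase (decide (κ' = 0)) (y (f p)) * tPhase (decide (κ = κ')) (y (f (p + 1))) := by
  have h : (tGate (decide (κ' = 0)) (f p)).flow y = y :=
    flowL_T (l := [tGate (decide (κ' = 0)) (f p)]) (by simp [tGate_isT]) y
  simp [tSlot₂, phL, tGate_ph, h, mul_comm]

/-- Two slots of `T` gates, the second one after the CNOT gates `Q`, in the frame obtained by the
CNOT gates `P`. -/
theorem phL_sandwich {P Q S : List (Gate k)} (hP : ∀ g ∈ P, g.isCNOT = true)
    (hQ : ∀ g ∈ Q, g.isCNOT = true) (hS : ∀ g ∈ S, g.isCNOT = true) (f : ℕ → Fin k) (p : ℕ)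
    (κ κ' : Fin 2) (y : Basis k) :
    phL (P ++ tSlot₁ f p κ ++ Q ++ tSlot₂ f p κ κ' ++ S) y =
      phL (tSlot₁ f p κ) (flowL P y) * phL (tSlot₂ f p κ κ') (flowL Q (flowL P y)) := by
  simp only [phL_append, flowL_append, phL_cnot hP, phL_cnot hQ, phL_cnot hS,
    flowL_T (isT_tSlot₁ f p κ), one_mul, mul_one]
  ring

theorem flowL_sandwich (P Q S : List (Gate k)) (f : ℕ → Fin k) (p : ℕ)
    (κ κ' : Fin 2) (y : Basis k) :
    flowL (P ++ tSlot₁ f p κ ++ Q ++ tSlot₂ f p κ κ' ++ S) y =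
      flowL S (flowL Q (flowL P y)) := by
  simp only [flowL_append, flowL_T (isT_tSlot₁ f p κ), flowL_T (isT_tSlot₂ f p κ κ')]

theorem classical_sandwich {P Q S : List (Gate k)} (hP : ∀ g ∈ P, g.Classical)
    (hQ : ∀ g ∈ Q, g.Classical) (hS : ∀ g ∈ S, g.Classical) (f : ℕ → Fin k) (p : ℕ)
    (κ κ' : Fin 2) : ∀ g ∈ P ++ tSlot₁ f p κ ++ Q ++ tSlot₂ f p κ κ' ++ S, g.Classical := by
  intro g hg
  rcases List.mem_append.mp hg with hg | hg
  · rcases List.mem_append.mp hg with hg | hg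
    · rcases List.mem_append.mp hg with hg | hg
      · rcases List.mem_append.mp hg with hg | hg
        · exact hP g hg
        · exact classical_tSlot₁ _ _ _ g hg
      · exact hQ g hg
    · exact classical_tSlot₂ _ _ _ _ g hg
  · exact hS g hg

/-- The data of a gadget: its target `b`, its controls `c` and `a` (positions on a path with
`b < c < a`), and the values `κc`, `κa` of the controls for which it fires. -/
structure Gadget where
  b : ℕ
  c : ℕ
  a : ℕ
  κc : Fin 2
  κa : Fin 2

namespace Gadget

/-- The gadget fits on a line of `k` qubits. -/
def Valid (g : Gadget) (k : ℕ) : Prop := g.b < g.c ∧ g.c < g.a ∧ g.a < k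

/-- The CNOT gates that collect in `c - 1` and `c` the parities from `b` on. -/
def up (f : ℕ → Fin k) (g : Gadget) : List (Gate k) := ladder f g.b (g.c - g.b)

/-- The CNOT gates that add the control `a` to these two parities. -/
def across (f : ℕ → Fin k) (g : Gadget) : List (Gate k) := spread f (g.c - 1) (g.a - g.c)

/-- Does the gadget flip its target? -/
def fires (f : ℕ → Fin k) (g : Gadget) (y : Basis k) : Fin 2 :=
  if y (f g.c) = g.κc ∧ y (f g.a) = g.κa then 1 else 0

/-- The qubits other than the target that the gadget changes. -/
def side (f : ℕ → Fin k) (g : Gadget) : Finset (Fin k) :=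
  (insert (g.c - 1) (Finset.Ioo g.c g.a)).image f

/-- The permutation of the basis states performed by the gates between the two Hadamard gates. -/
def innerFlow (f : ℕ → Fin k) (g : Gadget) (y : Basis k) : Basis k :=
  fun q => y q + if q ∈ g.side f then y (f g.a) else 0

/-- The permutation of the basis states performed by the gadget. -/
def gflow (f : ℕ → Fin k) (g : Gadget) (y : Basis k) : Basis k :=
  Function.update (g.innerFlow f y) (f g.b) (y (f g.b) + g.fires f y)

variable {f : ℕ → Fin k} {g : Gadget}

theorem isNearCNOTs_up (hf : IsPath f) (hg : g.Valid k) : IsNearCNOTs (g.up f) := by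
  obtain ⟨h1, h2, h3⟩ := hg
  exact isNearCNOTs_ladder hf (by omega)

theorem isNearCNOTs_across (hf : IsPath f) (hg : g.Valid k) : IsNearCNOTs (g.across f) := by
  obtain ⟨h1, h2, h3⟩ := hg
  exact isNearCNOTs_spread hf (by omega)

theorem flowL_up (hf : IsPath f) (hg : g.Valid k) (y : Basis k) {j : ℕ} (h1 : g.b ≤ j)
    (h2 : j ≤ g.c) :
    flowL (g.up f) y (f j) = ∑ i ∈ Finset.range (j - g.b + 1), y (f (g.b + i)) := by
  obtain ⟨h3, h4, h5⟩ := hg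
  have := flowL_ladder hf (b := g.b) (p := g.c - g.b) (by omega) y (j := j - g.b) (by omega)
  rwa [Nat.add_sub_cancel' h1] at this

theorem flowL_up_of_forall_ne (f : ℕ → Fin k) (g : Gadget) (y : Basis k) {q : Fin k}
    (hq : ∀ j, g.b < j → j ≤ g.c → q ≠ f j) : flowL (g.up f) y q = y q :=
  flowL_ladder_of_forall_ne f _ _ y fun j _ => hq _ (by omega) (by omega)

theorem flowL_up_a (hf : IsPath f) (hg : g.Valid k) (y : Basis k) :
    flowL (g.up f) y (f g.a) = y (f g.a) := by
  obtain ⟨h3, h4, h5⟩ := hg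
  exact flowL_up_of_forall_ne f g y fun j _ _ => hf.ne (by omega) (by omega) (by omega)

theorem flowL_across (hf : IsPath f) (hg : g.Valid k) (y : Basis k) {j : ℕ} (h1 : g.c ≤ j + 1)
    (h2 : j < g.a) : flowL (g.across f) y (f j) = y (f j) + y (f g.a) := by
  obtain ⟨h3, h4, h5⟩ := hg
  have := flowL_spread hf (p := g.c - 1) (d := g.a - g.c) (by omega) y (j := j - (g.c - 1))
    (by omega)
  rwa [show g.c - 1 + (j - (g.c - 1)) = j by omega,
    show g.c - 1 + (g.a - g.c) + 1 = g.a by omega] at this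

theorem flowL_across_of_forall_ne (hg : g.Valid k) (y : Basis k) {q : Fin k}
    (hq : ∀ j, g.c ≤ j + 1 → j < g.a → q ≠ f j) : flowL (g.across f) y q = y q := by
  obtain ⟨h3, h4, h5⟩ := hg
  exact flowL_spread_of_forall_ne f _ _ y fun j _ => hq _ (by omega) (by omega)

theorem mem_side (hf : IsPath f) (hg : g.Valid k) {j : ℕ} (hj : j < k) :
    f j ∈ g.side f ↔ j = g.c - 1 ∨ (g.c < j ∧ j < g.a) := by
  obtain ⟨h3, h4, h5⟩ := hg
  simp only [side, Finset.mem_image, Finset.mem_insert, Finset.mem_Ioo]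
  constructor
  · rintro ⟨i, hi, h⟩
    obtain rfl := hf.inj i (by omega) j hj h
    exact hi
  · exact fun h => ⟨j, h, rfl⟩

theorem flowL_inner (hf : IsPath f) (hg : g.Valid k) (y : Basis k) :
    flowL (invGates (g.up f)) (flowL (g.across f) (flowL (g.up f) y)) = g.innerFlow f y := by
  apply flowL_invGates_eq (isNearCNOTs_up hf hg).classical
  have hg' := hg
  obtain ⟨h3, h4, h5⟩ := hg
  funext q
  by_cases hq : ∃ j, g.b ≤ j ∧ j ≤ g.c ∧ q = f j
  · obtain ⟨j, hj1, hj2, rfl⟩ := hq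
    have e : ∀ i ∈ Finset.range (j - g.b + 1), g.innerFlow f y (f (g.b + i)) =
        y (f (g.b + i)) + if i = g.c - 1 - g.b then y (f g.a) else 0 := by
      intro i hi
      rw [Finset.mem_range] at hi
      rw [innerFlow]
      congr 1
      refine if_congr ?_ rfl rfl
      rw [mem_side hf hg' (by omega)]
      omega
    rw [flowL_up hf hg' _ hj1 hj2, Finset.sum_congr rfl e, Finset.sum_add_distrib,
      Finset.sum_ite_eq']
    by_cases hj : g.c ≤ j + 1
    · rw [flowL_across hf hg' _ hj (by omega), flowL_up hf hg' _ hj1 hj2, flowL_up_a hf hg',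
        if_pos (Finset.mem_range.mpr (by omega))]
    · rw [flowL_across_of_forall_ne hg', flowL_up hf hg' _ hj1 hj2,
        if_neg (by rw [Finset.mem_range]; omega), add_zero]
      intro i hi1 hi2
      exact hf.ne (by omega) (by omega) (by omega)
  · push Not at hq
    rw [flowL_up_of_forall_ne _ _ _ fun j h1 h2 => hq j (by omega) h2]
    by_cases hq' : ∃ j, g.c < j ∧ j < g.a ∧ q = f j
    · obtain ⟨j, hj1, hj2, rfl⟩ := hq'
      rw [flowL_across hf hg' _ (by omega) hj2, flowL_up_a hf hg',
        flowL_up_of_forall_ne _ _ _ fun j h1 h2 => hq j (by omega) h2, innerFlow,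
        if_pos ((mem_side hf hg' (by omega)).mpr (by omega))]
    · push Not at hq'
      rw [flowL_across_of_forall_ne hg',
        flowL_up_of_forall_ne _ _ _ fun j h1 h2 => hq j (by omega) h2, innerFlow, if_neg, add_zero]
      · simp only [side, Finset.mem_image, Finset.mem_insert, Finset.mem_Ioo]
        rintro ⟨i, hi | hi, rfl⟩
        · exact hq i (by omega) (by omega) rfl
        · exact hq' i hi.1 hi.2 rfl
      · intro i hi1 hi2
        rcases Nat.lt_or_ge g.c i with h | h
        · exact hq' i h hi2
        · exact hq i (by omega) h

/-- The gates between the two Hadamard gates. -/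
def inner (f : ℕ → Fin k) (g : Gadget) : List (Gate k) :=
  g.up f ++ tSlot₁ f (g.c - 1) g.κc ++ g.across f ++ tSlot₂ f (g.c - 1) g.κc g.κa ++
    invGates (g.up f)

theorem classical_inner (hf : IsPath f) (hg : g.Valid k) : ∀ x ∈ g.inner f, x.Classical :=
  classical_sandwich (isNearCNOTs_up hf hg).classical (isNearCNOTs_across hf hg).classical
    (isNearCNOTs_up hf hg).inv.classical f _ _ _

/-- The phase of the gadget between the two Hadamard gates, in terms of the parity of the bits
from `b` to `c - 1`, which the target enters, and of the controls. -/
theorem phL_slots (hf : IsPath f) (hg : g.Valid k) (y : Basis k) :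
    phL (tSlot₁ f (g.c - 1) g.κc) (flowL (g.up f) y) *
      phL (tSlot₂ f (g.c - 1) g.κc g.κa) (flowL (g.across f) (flowL (g.up f) y)) =
      fourPhase g.κc g.κa (∑ i ∈ Finset.range (g.c - g.b), y (f (g.b + i))) (y (f g.c))
        (y (f g.a)) := by
  have hg' := hg
  obtain ⟨h3, h4, h5⟩ := hg
  have hc : g.c - 1 + 1 = g.c := by omega
  have e : g.c - g.b + 1 = g.c - 1 - g.b + 1 + 1 := by omega
  rw [phL_tSlot₁, phL_tSlot₂, hc, flowL_across hf hg' _ (by omega) (by omega),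
    flowL_across hf hg' _ (by omega) (by omega), flowL_up_a hf hg',
    flowL_up hf hg' y (j := g.c) (by omega) (by omega),
    flowL_up hf hg' y (j := g.c - 1) (by omega) (by omega), e,
    Finset.sum_range_succ _ (g.c - 1 - g.b + 1), show g.b + (g.c - 1 - g.b + 1) = g.c by omega,
    show g.c - g.b = g.c - 1 - g.b + 1 by omega]
  rfl

/-- The gates of the gadget before its second slot of `T` gates. -/
def head (f : ℕ → Fin k) (g : Gadget) : List (Gate k) :=
  [.h (f g.b)] ++ g.up f ++ tSlot₁ f (g.c - 1) g.κc ++ g.across f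

/-- Between Hadamard gates, the sign of the phase becomes a flip of the target: the gadget is a
doubly controlled NOT gate up to phases and up to further CNOT gates controlled by `a`. -/
theorem exists_seqOp_eq_mono (hf : IsPath f) (hg : g.Valid k) :
    ∃ φ, seqOp (g.head f ++ tSlot₂ f (g.c - 1) g.κc g.κa ++ invGates (g.up f) ++ [.h (f g.b)]) =
      mono (g.gflow f) φ := by
  have hg' := hg
  obtain ⟨h3, h4, h5⟩ := hg
  have hca : ∀ (y : Basis k) s, Function.update y (f g.b) s (f g.a) = y (f g.a) := fun y s =>
    Function.update_of_ne (hf.ne (by omega) (by omega) (by omega)) ..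
  have hcc : ∀ (y : Basis k) s, Function.update y (f g.b) s (f g.c) = y (f g.c) := fun y s =>
    Function.update_of_ne (hf.ne (by omega) (by omega) (by omega)) ..
  have h := hadamard_conj_mono (b := f g.b) (π := g.innerFlow f) (φ := phL (g.inner f))
    (fun y => if f g.b ∈ g.side f then y (f g.a) else 0) (g.fires f)
    (by
      intro y s j hj
      rw [innerFlow, innerFlow, Function.update_of_ne hj, hca])
    (fun y => rfl)
    (by intro y s; rw [hca])
    (by
      intro y
      have e : Function.update y (f g.b) 1 = flip (f g.b) (Function.update y (f g.b) 0) := by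
        simp [flip]
      have hs := sum_flip_of_mem hf (b := g.b) (p := g.c - g.b) (i := 0) (by omega) (by omega)
        (Function.update y (f g.b) 0)
      have hu := isNearCNOTs_up hf hg'
      rw [inner, phL_sandwich hu.isCNOT (isNearCNOTs_across hf hg').isCNOT hu.inv.isCNOT,
        phL_sandwich hu.isCNOT (isNearCNOTs_across hf hg').isCNOT hu.inv.isCNOT,
        phL_slots hf hg', phL_slots hf hg', hcc, hcc, hca, hca, e]
      rw [add_zero] at hs
      rw [hs, fourPhase_add_one]
      congr 1
      simp [fires])
  refine ⟨_, Eq.trans ?_ h⟩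
  have e : g.head f ++ tSlot₂ f (g.c - 1) g.κc g.κa ++ invGates (g.up f) ++ [Gate.h (f g.b)] =
      Gate.h (f g.b) :: (g.inner f ++ [Gate.h (f g.b)]) := by
    simp [head, inner]
  have hflow : flowL (g.inner f) = g.innerFlow f := by
    funext y
    rw [inner, flowL_sandwich, flowL_inner hf hg']
  rw [e, seqOp_cons, seqOp_append, seqOp_eq_mono (classical_inner hf hg'), hflow]
  simp [mul_assoc]

/-- The gadget changes only its target and the qubits of `side`. -/
theorem gflow_of_notMem {y : Basis k} {q : Fin k} (hb : q ≠ f g.b) (hs : q ∉ g.side f) :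
    g.gflow f y q = y q := by
  rw [gflow, Function.update_of_ne hb, innerFlow, if_neg hs, add_zero]

theorem gflow_b (y : Basis k) : g.gflow f y (f g.b) = y (f g.b) + g.fires f y :=
  Function.update_self ..

theorem gflow_flip {t : Fin k} (hb : t ≠ f g.b) (hc : t ≠ f g.c) (ha : t ≠ f g.a) (y : Basis k) :
    g.gflow f (flip t y) = flip t (g.gflow f y) := by
  have hfire : g.fires f (flip t y) = g.fires f y := by
    rw [fires, fires, flip_of_ne hc.symm, flip_of_ne ha.symm]
  funext q
  by_cases hq : q = f g.b
  · subst hq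
    rw [gflow_b, flip_of_ne hb.symm, flip_of_ne hb.symm, gflow_b, hfire]
  · rw [gflow, Function.update_of_ne hq, innerFlow, flip_of_ne ha.symm]
    by_cases hqt : q = t
    · subst hqt
      rw [flip_self, flip_self, gflow, Function.update_of_ne hq, innerFlow]
      abel
    · rw [flip_of_ne hqt, flip_of_ne hqt, gflow, Function.update_of_ne hq, innerFlow]

end Gadget

/-! ### Resources of circuits -/

theorem Gate.IsLNN.wf {g : Gate k} (h : g.IsLNN) : g.WF := by
  cases g with
  | cnot c q =>
    rintro rfl
    simp [Gate.IsLNN] at h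
  | _ => trivial

/-- The circuit respects the connectivity of the line, uses exactly `r` rotations, at most `x`
CNOT gates, at most `t` `T` gates in at most `td` slots, and at most `h` Hadamard gates in at most
`hd` slots.  The CNOT depth is bounded by the same number `x` as the CNOT cost. -/
structure Uses (c : Circuit k) (r x t td h hd : ℕ) : Prop where
  lnn : c.IsLNN
  rot : c.cost Gate.isRotation = r
  cnot : c.cost Gate.isCNOT ≤ x
  cnotDepth : c.depth Gate.isCNOT ≤ x
  t : c.cost Gate.isT ≤ t
  tDepth : c.depth Gate.isT ≤ td
  h : c.cost Gate.isH ≤ h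
  hDepth : c.depth Gate.isH ≤ hd

theorem cost_append (c d : Circuit k) (p : Gate k → Bool) :
    Circuit.cost (c ++ d) p = c.cost p + d.cost p := by
  simp [Circuit.cost]

theorem depth_append (c d : Circuit k) (p : Gate k → Bool) :
    Circuit.depth (c ++ d) p = c.depth p + d.depth p := by
  simp [Circuit.depth]

theorem Uses.nil : Uses ([] : Circuit k) 0 0 0 0 0 0 := by
  constructor <;> simp [Circuit.IsLNN, Circuit.cost, Circuit.depth]

theorem Uses.append {c d : Circuit k} {r x t td h hd r' x' t' td' h' hd' : ℕ}
    (hc : Uses c r x t td h hd) (hc' : Uses d r' x' t' td' h' hd') :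
    Uses (c ++ d) (r + r') (x + x') (t + t') (td + td') (h + h') (hd + hd') where
  lnn := by
    intro s hs
    rcases List.mem_append.mp hs with hs | hs
    exacts [hc.lnn s hs, hc'.lnn s hs]
  rot := by rw [cost_append, hc.rot, hc'.rot]
  cnot := by rw [cost_append]; exact Nat.add_le_add hc.cnot hc'.cnot
  cnotDepth := by rw [depth_append]; exact Nat.add_le_add hc.cnotDepth hc'.cnotDepth
  t := by rw [cost_append]; exact Nat.add_le_add hc.t hc'.t
  tDepth := by rw [depth_append]; exact Nat.add_le_add hc.tDepth hc'.tDepth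
  h := by rw [cost_append]; exact Nat.add_le_add hc.h hc'.h
  hDepth := by rw [depth_append]; exact Nat.add_le_add hc.hDepth hc'.hDepth

/-- The gates of a list, one after the other. -/
def serial (l : List (Gate k)) : Circuit k := l.map fun g => [g]

theorem flatten_serial (l : List (Gate k)) : (serial l).flatten = l := by
  induction l with
  | nil => rfl
  | cons g l ih => simpa [serial] using ih

theorem cost_serial (l : List (Gate k)) (p : Gate k → Bool) :
    (serial l).cost p = l.countP p := by rw [Circuit.cost, flatten_serial]

theorem depth_serial (l : List (Gate k)) (p : Gate k → Bool) :
    (serial l).depth p = l.countP p := by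
  simp [Circuit.depth, serial, List.countP_map, Function.comp_def]

theorem isLNN_serial {l : List (Gate k)} (hl : ∀ g ∈ l, g.IsLNN) : (serial l).IsLNN := by
  intro s hs
  obtain ⟨g, hg, rfl⟩ := List.mem_map.mp hs
  exact ⟨by simpa using hl g hg, List.pairwise_singleton _ _⟩

theorem Uses.serial_cnot {l : List (Gate k)} (hl : IsNearCNOTs l) :
    Uses (serial l) 0 l.length 0 0 0 0 := by
  have hz : ∀ p : Gate k → Bool, (∀ g, g.isCNOT = true → p g = false) → l.countP p = 0 := by
    intro p hp
    rw [List.countP_eq_zero]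
    intro g hg
    simp [hp g (hl g hg).1]
  refine ⟨isLNN_serial fun g hg => (hl g hg).2, ?_, ?_, ?_, ?_, ?_, ?_, ?_⟩ <;>
    simp only [cost_serial, depth_serial]
  · exact hz _ fun g hg => by cases g <;> first | rfl | exact absurd hg Bool.false_ne_true
  · exact List.countP_le_length
  · exact List.countP_le_length
  all_goals
    exact (hz _ fun g hg => by cases g <;> first | rfl | exact absurd hg Bool.false_ne_true).le

theorem Uses.serial_rotation {l : List (Gate k)} (hl : ∀ g ∈ l, g.isRotation = true) :
    Uses (serial l) l.length 0 0 0 0 0 := by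
  have hz : ∀ p : Gate k → Bool, (∀ g, g.isRotation = true → p g = false) → l.countP p = 0 := by
    intro p hp
    rw [List.countP_eq_zero]
    intro g hg
    simp [hp g (hl g hg)]
  refine ⟨isLNN_serial fun g hg => ?_, ?_, ?_, ?_, ?_, ?_, ?_, ?_⟩
  · cases g <;> first | trivial | exact absurd (hl _ hg) Bool.false_ne_true
  · rw [cost_serial, List.countP_eq_length]
    exact hl
  all_goals
    simp only [cost_serial, depth_serial]
    refine (hz _ fun g hg => ?_).le
    cases g <;> first | rfl | exact absurd hg Bool.false_ne_true

theorem depth_singleton_le (s : List (Gate k)) (p : Gate k → Bool) :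
    Circuit.depth [s] p ≤ 1 := by
  rw [Circuit.depth]
  exact List.countP_le_length

theorem depth_singleton_eq_zero {s : List (Gate k)} {p : Gate k → Bool}
    (h : ∀ g ∈ s, p g = false) : Circuit.depth [s] p = 0 := by
  rw [Circuit.depth, List.countP_eq_zero]
  simpa using h

theorem Uses.slot_T {s : List (Gate k)} (hs : ∀ g ∈ s, g.isT = true)
    (hd : s.Pairwise fun g g' => Disjoint g.qubits g'.qubits) :
    Uses [s] 0 0 s.length 1 0 0 := by
  have hf : ∀ g ∈ s, g.isRotation = false ∧ g.isCNOT = false ∧ g.isH = false ∧ g.IsLNN := by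
    intro g hg
    cases g <;> first | exact ⟨rfl, rfl, rfl, trivial⟩ | exact absurd (hs _ hg) Bool.false_ne_true
  have hz : ∀ p : Gate k → Bool, (∀ g ∈ s, p g = false) → Circuit.cost [s] p = 0 := by
    intro p hp
    simpa [Circuit.cost] using hp
  refine ⟨?_, hz _ fun g hg => (hf g hg).1, (hz _ fun g hg => (hf g hg).2.1).le,
    (depth_singleton_eq_zero fun g hg => (hf g hg).2.1).le, ?_, depth_singleton_le _ _,
    (hz _ fun g hg => (hf g hg).2.2.1).le,
    (depth_singleton_eq_zero fun g hg => (hf g hg).2.2.1).le⟩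
  · intro s' hs'
    rw [List.mem_singleton] at hs'
    subst hs'
    exact ⟨fun g hg => (hf g hg).2.2.2, hd⟩
  · simpa [Circuit.cost] using List.countP_le_length

theorem Uses.slot_H {s : List (Gate k)} (hs : ∀ g ∈ s, g.isH = true)
    (hd : s.Pairwise fun g g' => Disjoint g.qubits g'.qubits) :
    Uses [s] 0 0 0 0 s.length 1 := by
  have hf : ∀ g ∈ s, g.isRotation = false ∧ g.isCNOT = false ∧ g.isT = false ∧ g.IsLNN := by
    intro g hg
    cases g <;> first | exact ⟨rfl, rfl, rfl, trivial⟩ | exact absurd (hs _ hg) Bool.false_ne_true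
  have hz : ∀ p : Gate k → Bool, (∀ g ∈ s, p g = false) → Circuit.cost [s] p = 0 := by
    intro p hp
    simpa [Circuit.cost] using hp
  refine ⟨?_, hz _ fun g hg => (hf g hg).1, (hz _ fun g hg => (hf g hg).2.1).le,
    (depth_singleton_eq_zero fun g hg => (hf g hg).2.1).le,
    (hz _ fun g hg => (hf g hg).2.2.1).le,
    (depth_singleton_eq_zero fun g hg => (hf g hg).2.2.1).le, ?_, depth_singleton_le _ _⟩
  · intro s' hs'
    rw [List.mem_singleton] at hs'
    subst hs'
    exact ⟨fun g hg => (hf g hg).2.2.2, hd⟩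
  · simpa [Circuit.cost] using List.countP_le_length

/-- The inverse circuit. -/
def inverse (c : Circuit k) : Circuit k := (c.map invGates).reverse

theorem flatten_inverse (c : Circuit k) : (inverse c).flatten = invGates c.flatten := by
  induction c with
  | nil => rfl
  | cons s c ih =>
    rw [List.flatten_cons, invGates_append, ← ih]
    simp [inverse]

theorem countP_invGates {p : Gate k → Bool} (hp : ∀ g : Gate k, p g.inv = p g)
    (l : List (Gate k)) : (invGates l).countP p = l.countP p := by
  simp [invGates, List.countP_map, Function.comp_def, hp]

theorem any_invGates {p : Gate k → Bool} (hp : ∀ g : Gate k, p g.inv = p g)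
    (l : List (Gate k)) : (invGates l).any p = l.any p := by
  simp [invGates, Function.comp_def, hp]

theorem cost_inverse {p : Gate k → Bool} (hp : ∀ g : Gate k, p g.inv = p g) (c : Circuit k) :
    (inverse c).cost p = c.cost p := by
  rw [Circuit.cost, flatten_inverse, countP_invGates hp, Circuit.cost]

theorem depth_inverse {p : Gate k → Bool} (hp : ∀ g : Gate k, p g.inv = p g) (c : Circuit k) :
    (inverse c).depth p = c.depth p := by
  simp [Circuit.depth, inverse, List.countP_map, Function.comp_def, any_invGates hp]

theorem Gate.qubits_inv (g : Gate k) : g.inv.qubits = g.qubits := by cases g <;> rfl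

theorem isLNN_inverse {c : Circuit k} (hc : c.IsLNN) : (inverse c).IsLNN := by
  intro s hs
  simp only [inverse, List.mem_reverse, List.mem_map] at hs
  obtain ⟨s', hs', rfl⟩ := hs
  obtain ⟨h1, h2⟩ := hc s' hs'
  constructor
  · intro g hg
    obtain ⟨g', hg', rfl⟩ := mem_invGates hg
    have := h1 g' hg'
    cases g' <;> exact this
  · rw [invGates, List.pairwise_reverse, List.pairwise_map]
    refine h2.imp fun {a b} h => ?_
    rw [Gate.qubits_inv, Gate.qubits_inv]
    exact h.symm

theorem Uses.inverse {c : Circuit k} {r x t td h hd : ℕ} (hc : Uses c r x t td h hd) :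
    Uses (inverse c) r x t td h hd := by
  have h1 : ∀ g : Gate k, g.inv.isRotation = g.isRotation := fun g => by cases g <;> rfl
  have h2 : ∀ g : Gate k, g.inv.isCNOT = g.isCNOT := fun g => by cases g <;> rfl
  have h3 : ∀ g : Gate k, g.inv.isT = g.isT := fun g => by cases g <;> rfl
  have h4 : ∀ g : Gate k, g.inv.isH = g.isH := fun g => by cases g <;> rfl
  refine ⟨isLNN_inverse hc.lnn, ?_, ?_, ?_, ?_, ?_, ?_, ?_⟩
  · rw [cost_inverse h1, hc.rot]
  · rw [cost_inverse h2]; exact hc.cnot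
  · rw [depth_inverse h2]; exact hc.cnotDepth
  · rw [cost_inverse h3]; exact hc.t
  · rw [depth_inverse h3]; exact hc.tDepth
  · rw [cost_inverse h4]; exact hc.h
  · rw [depth_inverse h4]; exact hc.hDepth

theorem Circuit.IsLNN.wf {c : Circuit k} (hc : c.IsLNN) : ∀ g ∈ c.flatten, g.WF := by
  intro g hg
  obtain ⟨s, hs, hgs⟩ := List.mem_flatten.mp hg
  exact ((hc s hs).1 g hgs).wf

theorem toOp_append (c d : Circuit k) : Circuit.toOp (c ++ d) = d.toOp * c.toOp := by
  rw [Circuit.toOp, List.flatten_append, seqOp_append]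
  rfl

theorem toOp_serial (l : List (Gate k)) : (serial l).toOp = seqOp l := by
  rw [Circuit.toOp, flatten_serial]

theorem toOp_inverse_mul {c : Circuit k} (hc : c.IsLNN) : (inverse c).toOp * c.toOp = 1 := by
  rw [Circuit.toOp, flatten_inverse]
  exact seqOp_invGates_mul hc.wf

/-! ### Sequences of gadgets with shared time slots -/

/-- The gates `Y i` may be postponed to the end of the sequence if they act on other qubits than
the gates `X j` with `j` later than `i`. -/
theorem seqOp_postpone {ι : Type*} (X Y : ι → List (Gate k)) {L : List ι}
    (hX : ∀ i ∈ L, ∀ g ∈ X i, g.WF) (hY : ∀ i ∈ L, ∀ g ∈ Y i, g.WF)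
    (hd : L.Pairwise fun i j => ∀ g ∈ Y i, ∀ g' ∈ X j, Disjoint g.qubits g'.qubits) :
    seqOp (L.flatMap X ++ L.flatMap Y) = seqOp (L.flatMap fun i => X i ++ Y i) := by
  induction L with
  | nil => rfl
  | cons i L ih =>
    rw [List.pairwise_cons] at hd
    have ih := ih (fun j hj => hX j (by simp [hj])) (fun j hj => hY j (by simp [hj])) hd.2
    have hc : Commute (seqOp (Y i)) (seqOp (L.flatMap X)) := by
      refine seqOp_commute (hY i (by simp)) ?_ ?_
      · intro g hg
        obtain ⟨j, hj, hg⟩ := List.mem_flatMap.mp hg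
        exact hX j (by simp [hj]) g hg
      · intro g hg g' hg'
        obtain ⟨j, hj, hg'⟩ := List.mem_flatMap.mp hg'
        exact hd.1 j hj g hg g' hg'
    rw [seqOp_append] at ih
    simp only [List.flatMap_cons, seqOp_append]
    rw [← ih]
    simp only [mul_assoc]
    rw [← mul_assoc (seqOp (Y i)), hc.eq]
    simp only [mul_assoc]

/-- All the gates act on positions from `lo` to `hi` of the path. -/
def ActsOn (f : ℕ → Fin k) (lo hi : ℕ) (l : List (Gate k)) : Prop :=
  ∀ g ∈ l, ∀ q ∈ g.qubits, ∃ j, lo ≤ j ∧ j ≤ hi ∧ q = f j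

theorem ActsOn.append {f : ℕ → Fin k} {lo hi : ℕ} {l l' : List (Gate k)} (h : ActsOn f lo hi l)
    (h' : ActsOn f lo hi l') : ActsOn f lo hi (l ++ l') := by
  intro g hg
  rcases List.mem_append.mp hg with hg | hg
  exacts [h g hg, h' g hg]

theorem ActsOn.inv {f : ℕ → Fin k} {lo hi : ℕ} {l : List (Gate k)} (h : ActsOn f lo hi l) :
    ActsOn f lo hi (invGates l) := by
  intro g hg
  obtain ⟨g', hg', rfl⟩ := mem_invGates hg
  rw [Gate.qubits_inv]
  exact h g' hg'

theorem ActsOn.mono {f : ℕ → Fin k} {lo hi lo' hi' : ℕ} {l : List (Gate k)}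
    (h : ActsOn f lo hi l) (h1 : lo' ≤ lo) (h2 : hi ≤ hi') : ActsOn f lo' hi' l := by
  intro g hg q hq
  obtain ⟨j, h3, h4, h5⟩ := h g hg q hq
  exact ⟨j, by omega, by omega, h5⟩

theorem ActsOn.disjoint {f : ℕ → Fin k} (hf : IsPath f) {lo hi lo' hi' : ℕ}
    {l l' : List (Gate k)} (h : ActsOn f lo hi l) (h' : ActsOn f lo' hi' l') (h1 : hi < lo')
    (h2 : hi' < k) : ∀ g ∈ l, ∀ g' ∈ l', Disjoint g.qubits g'.qubits := by
  intro g hg g' hg'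
  rw [Finset.disjoint_left]
  intro q hq hq'
  obtain ⟨i, h3, h4, rfl⟩ := h g hg q hq
  obtain ⟨j, h5, h6, h7⟩ := h' g' hg' _ hq'
  exact hf.ne (by omega) (by omega) (by omega) h7

theorem actsOn_ladder (f : ℕ → Fin k) (b p : ℕ) : ActsOn f b (b + p) (ladder f b p) := by
  intro g hg q hq
  simp only [ladder, List.mem_map, List.mem_range] at hg
  obtain ⟨i, hi, rfl⟩ := hg
  simp only [Gate.qubits, Finset.mem_insert, Finset.mem_singleton] at hq
  rcases hq with rfl | rfl
  exacts [⟨b + i, by omega, by omega, rfl⟩, ⟨b + i + 1, by omega, by omega, rfl⟩]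

theorem actsOn_spread (f : ℕ → Fin k) (p d : ℕ) : ActsOn f p (p + d + 1) (spread f p d) := by
  have h1 : ∀ p, ActsOn f p (p + 1) [.cnot (f (p + 1)) (f p)] := by
    intro p g hg q hq
    rw [List.mem_singleton] at hg
    subst hg
    simp only [Gate.qubits, Finset.mem_insert, Finset.mem_singleton] at hq
    rcases hq with rfl | rfl
    exacts [⟨p + 1, by omega, by omega, rfl⟩, ⟨p, by omega, by omega, rfl⟩]
  induction d generalizing p with
  | zero => exact h1 p
  | succ d ih =>
    have h2 := (h1 p).mono le_rfl (show p + 1 ≤ p + (d + 1) + 1 by omega)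
    exact h2.append (((ih (p + 1)).mono (by omega) (by omega)).append h2)

theorem actsOn_singleton {f : ℕ → Fin k} {lo hi j : ℕ} {g : Gate k} (hg : g.qubits = {f j})
    (h1 : lo ≤ j) (h2 : j ≤ hi) : ActsOn f lo hi [g] := by
  intro g' hg' q hq
  rw [List.mem_singleton] at hg'
  subst hg'
  rw [hg, Finset.mem_singleton] at hq
  exact ⟨j, h1, h2, hq⟩

theorem pairwise_tGates {f : ℕ → Fin k} (hf : IsPath f) {p : ℕ} (hp : p + 1 < k) (s s' : Bool) :
    [tGate s (f p), tGate s' (f (p + 1))].Pairwise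
      fun g g' => Disjoint g.qubits g'.qubits := by
  simpa [tGate_qubits] using hf.ne (by omega) hp (by omega)

namespace Gadget

variable {f : ℕ → Fin k} {g : Gadget}

theorem actsOn_up (hg : g.Valid k) : ActsOn f g.b g.c (g.up f) := by
  obtain ⟨h3, h4, h5⟩ := hg
  exact (actsOn_ladder f _ _).mono le_rfl (by omega)

theorem actsOn_tSlot₂ (hg : g.Valid k) :
    ActsOn f g.b g.c (tSlot₂ f (g.c - 1) g.κc g.κa) := by
  obtain ⟨h3, h4, h5⟩ := hg
  exact (actsOn_singleton (tGate_qubits _ _) (by omega) (by omega)).append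
    (actsOn_singleton (tGate_qubits _ _) (by omega) (by omega))

theorem actsOn_head (hg : g.Valid k) : ActsOn f g.b g.a (g.head f) := by
  have h := actsOn_up (f := f) hg
  obtain ⟨h3, h4, h5⟩ := hg
  refine (((actsOn_singleton rfl le_rfl (by omega)).append (h.mono le_rfl (by omega))).append
    ((actsOn_singleton (tGate_qubits _ _) (by omega) (by omega)).append
    (actsOn_singleton (tGate_qubits _ _) (by omega) (by omega)))).append
    ((actsOn_spread f _ _).mono (by omega) (by omega))

theorem wf_head (hf : IsPath f) (hg : g.Valid k) : ∀ x ∈ g.head f, x.WF := by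
  intro x hx
  simp only [head, List.mem_append, List.mem_singleton] at hx
  rcases hx with ((rfl | hx) | hx) | hx
  · trivial
  · exact ((isNearCNOTs_up hf hg).classical x hx).wf
  · exact (classical_tSlot₁ _ _ _ x hx).wf
  · exact ((isNearCNOTs_across hf hg).classical x hx).wf

/-- The circuit of the gadget before its second slot of `T` gates. -/
def headCircuit (f : ℕ → Fin k) (g : Gadget) : Circuit k :=
  [[.h (f g.b)]] ++ serial (g.up f) ++ [tSlot₁ f (g.c - 1) g.κc] ++ serial (g.across f)

theorem flatten_headCircuit (f : ℕ → Fin k) (g : Gadget) :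
    (g.headCircuit f).flatten = g.head f := by
  simp [headCircuit, head, flatten_serial]

theorem uses_headCircuit (hf : IsPath f) (hg : g.Valid k) :
    Uses (g.headCircuit f) 0 (g.c - g.b + (2 * (g.a - g.c) + 1)) 2 1 1 1 := by
  have h1 : Uses [[Gate.h (f g.b)]] 0 0 0 0 1 1 :=
    Uses.slot_H (by simp [Gate.isH]) (List.pairwise_singleton _ _)
  have h2 := Uses.serial_cnot (isNearCNOTs_up hf hg)
  have h4 := Uses.serial_cnot (isNearCNOTs_across hf hg)
  obtain ⟨h5, h6, h7⟩ := hg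
  have h3 := Uses.slot_T (isT_tSlot₁ f (g.c - 1) g.κc) (pairwise_tGates hf (by omega) _ _)
  have := ((h1.append h2).append h3).append h4
  simpa [up, across, tSlot₁, headCircuit] using this

end Gadget

/-- The first `N` gadgets of the sequence fit on the line, and each one has its first control
before the target of the later ones. -/
structure IsStaircase (G : ℕ → Gadget) (N k : ℕ) : Prop where
  valid : ∀ i < N, (G i).Valid k
  lt : ∀ i j, i < j → j < N → (G i).c < (G j).b

theorem IsStaircase.pairwise {G : ℕ → Gadget} {N : ℕ} (hG : IsStaircase G N k)
    {R : ℕ → ℕ → Prop}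
    (hR : ∀ i j, (G i).Valid k → (G j).Valid k → (G i).c < (G j).b → R i j) :
    (List.range N).Pairwise R := by
  refine List.pairwise_lt_range.imp_of_mem fun {i j} hi hj hij => ?_
  rw [List.mem_range] at hi hj
  exact hR i j (hG.valid i hi) (hG.valid j hj) (hG.lt i j hij hj)

/-- The circuit of a sequence of gadgets, in which all second slots of `T` gates are merged into
one slot, and so are the final Hadamard gates. -/
def staircase (f : ℕ → Fin k) (G : ℕ → Gadget) (N : ℕ) : Circuit k :=
  (List.range N).flatMap (fun i => (G i).headCircuit f) ++
    [(List.range N).flatMap fun i => tSlot₂ f ((G i).c - 1) (G i).κc (G i).κa] ++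
    serial ((List.range N).flatMap fun i => invGates ((G i).up f)) ++
    [(List.range N).flatMap fun i => [.h (f (G i).b)]]

/-- The permutation of the basis states performed by a sequence of gadgets. -/
def staircaseFlow (f : ℕ → Fin k) (G : ℕ → Gadget) : ℕ → Basis k → Basis k
  | 0 => id
  | N + 1 => (G N).gflow f ∘ staircaseFlow f G N

theorem flatten_flatMap_headCircuit (f : ℕ → Fin k) (G : ℕ → Gadget) (L : List ℕ) :
    (L.flatMap fun i => (G i).headCircuit f).flatten = L.flatMap fun i => (G i).head f := by
  induction L with
  | nil => rfl
  | cons i L ih => simp [ih, Gadget.flatten_headCircuit]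

theorem toOp_staircase {f : ℕ → Fin k} (hf : IsPath f) {G : ℕ → Gadget} {N : ℕ}
    (hG : IsStaircase G N k) :
    ∃ φ, (staircase f G N).toOp = mono (staircaseFlow f G N) φ := by
  let X := fun i => (G i).head f
  let S := fun i => tSlot₂ f ((G i).c - 1) (G i).κc (G i).κa
  let I := fun i => invGates ((G i).up f)
  let K := fun i => [Gate.h (f (G i).b)]
  have wX : ∀ i ∈ List.range N, ∀ g ∈ X i, g.WF := fun i hi =>
    Gadget.wf_head hf (hG.valid i (List.mem_range.mp hi))
  have wS : ∀ i ∈ List.range N, ∀ g ∈ S i, g.WF := fun i _ g hg =>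
    (classical_tSlot₂ _ _ _ _ g hg).wf
  have wI : ∀ i ∈ List.range N, ∀ g ∈ I i, g.WF := fun i hi g hg =>
    ((Gadget.isNearCNOTs_up hf (hG.valid i (List.mem_range.mp hi))).inv.classical g hg).wf
  have wK : ∀ i ∈ List.range N, ∀ g ∈ K i, g.WF := by
    intro i _ g hg
    obtain rfl := List.mem_singleton.mp hg
    trivial
  have aX : ∀ j, (G j).Valid k → ActsOn f (G j).b (k - 1) (X j) := fun j hj =>
    (Gadget.actsOn_head hj).mono le_rfl (by have := hj.2.2; omega)
  have aS : ∀ j, (G j).Valid k → ActsOn f (G j).b (G j).c (S j) := fun j hj =>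
    Gadget.actsOn_tSlot₂ hj
  have aI : ∀ j, (G j).Valid k → ActsOn f (G j).b (G j).c (I j) := fun j hj =>
    (Gadget.actsOn_up hj).inv
  have aK : ∀ j, (G j).Valid k → ActsOn f (G j).b (G j).c (K j) := fun j hj =>
    actsOn_singleton rfl le_rfl hj.1.le
  have up : ∀ j, (G j).Valid k → (G j).c ≤ k - 1 := fun j hj => by
    have := hj.2.1; have := hj.2.2; omega
  have wXS : ∀ i ∈ List.range N, ∀ g ∈ X i ++ S i, g.WF := fun i hi g hg =>
    (List.mem_append.mp hg).elim (wX i hi g) (wS i hi g)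
  have aXS : ∀ j, (G j).Valid k → ActsOn f (G j).b (k - 1) (X j ++ S j) := fun j hj =>
    (aX j hj).append ((aS j hj).mono le_rfl (up j hj))
  have wXSI : ∀ i ∈ List.range N, ∀ g ∈ X i ++ S i ++ I i, g.WF := fun i hi g hg =>
    (List.mem_append.mp hg).elim (wXS i hi g) (wI i hi g)
  have aXSI : ∀ j, (G j).Valid k → ActsOn f (G j).b (k - 1) (X j ++ S j ++ I j) := fun j hj =>
    (aXS j hj).append ((aI j hj).mono le_rfl (up j hj))
  have lt : ∀ j, (G j).Valid k → k - 1 < k := fun j hj => by have := hj.2.2; omega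
  -- Postpone, one after the other, the second `T` slots, the inverse CNOT gates and the Hadamard
  -- gates of all gadgets.
  have e1 := seqOp_postpone X S wX wS
    (hG.pairwise fun i j hi hj h => (aS i hi).disjoint hf (aX j hj) h (lt j hj))
  have e2 := seqOp_postpone _ I wXS wI
    (hG.pairwise fun i j hi hj h => (aI i hi).disjoint hf (aXS j hj) h (lt j hj))
  have e3 := seqOp_postpone _ K wXSI wK
    (hG.pairwise fun i j hi hj h => (aK i hi).disjoint hf (aXSI j hj) h (lt j hj))
  have e : (staircase f G N).toOp =
      seqOp ((List.range N).flatMap fun i => X i ++ S i ++ I i ++ K i) := by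
    have h : (staircase f G N).flatten = (List.range N).flatMap X ++ (List.range N).flatMap S ++
        (List.range N).flatMap I ++ (List.range N).flatMap K := by
      simp only [staircase, List.flatten_append, flatten_flatMap_headCircuit, flatten_serial,
        List.flatten_singleton]
      rfl
    rw [Circuit.toOp, h, ← e3, seqOp_append, seqOp_append _ (List.flatMap K _), ← e2, seqOp_append,
      seqOp_append _ (List.flatMap I _), ← e1]
  rw [e]
  clear e e1 e2 e3 wX wS wI wK wXS wXSI
  have hv := hG.valid
  clear hG
  induction N with
  | zero => exact ⟨_, mono_id_one.symm⟩
  | succ N ih =>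
    obtain ⟨φ, hφ⟩ := ih fun i hi => hv i (by omega)
    obtain ⟨ψ, hψ⟩ := Gadget.exists_seqOp_eq_mono hf (hv N (by omega))
    refine ⟨fun y => ψ (staircaseFlow f G N y) * φ y, ?_⟩
    rw [List.range_succ, List.flatMap_append, seqOp_append, hφ, List.flatMap_singleton]
    simp only [X, S, I, K]
    rw [hψ, mono_mul_mono]
    rfl

theorem uses_flatMap_headCircuit {f : ℕ → Fin k} (hf : IsPath f) {G : ℕ → Gadget} {N : ℕ}
    (hv : ∀ i < N, (G i).Valid k) :
    Uses ((List.range N).flatMap fun i => (G i).headCircuit f) 0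
      (∑ i ∈ Finset.range N, ((G i).c - (G i).b + (2 * ((G i).a - (G i).c) + 1)))
      (2 * N) N N N := by
  induction N with
  | zero => exact Uses.nil
  | succ N ih =>
    rw [List.range_succ, List.flatMap_append, List.flatMap_singleton, Finset.sum_range_succ]
    exact (ih fun i hi => hv i (by omega)).append (Gadget.uses_headCircuit hf (hv N (by omega)))

theorem length_flatMap_range {α : Type*} (F : ℕ → List α) (N : ℕ) :
    ((List.range N).flatMap F).length = ∑ i ∈ Finset.range N, (F i).length := by
  induction N with
  | zero => rfl
  | succ N ih => simp [List.range_succ, Finset.sum_range_succ, ih]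

theorem uses_staircase {f : ℕ → Fin k} (hf : IsPath f) {G : ℕ → Gadget} {N : ℕ}
    (hG : IsStaircase G N k) :
    Uses (staircase f G N) 0 (∑ i ∈ Finset.range N, (2 * ((G i).a - (G i).b) + 1))
      (4 * N) (N + 1) (2 * N) (N + 1) := by
  have h1 := uses_flatMap_headCircuit hf hG.valid
  have h2 : Uses [(List.range N).flatMap fun i => tSlot₂ f ((G i).c - 1) (G i).κc (G i).κa]
      0 0 (2 * N) 1 0 0 := by
    have := Uses.slot_T (k := k)
      (s := (List.range N).flatMap fun i => tSlot₂ f ((G i).c - 1) (G i).κc (G i).κa) ?_ ?_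
    · rw [length_flatMap_range] at this
      simpa [tSlot₂, mul_comm] using this
    · intro g hg
      obtain ⟨i, _, hg⟩ := List.mem_flatMap.mp hg
      exact isT_tSlot₂ _ _ _ _ g hg
    · rw [List.pairwise_flatMap]
      constructor
      · intro i hi
        obtain ⟨h3, h4, h5⟩ := hG.valid i (List.mem_range.mp hi)
        exact pairwise_tGates hf (by omega) _ _
      · exact hG.pairwise fun i j hi hj h =>
          (Gadget.actsOn_tSlot₂ hi).disjoint hf (Gadget.actsOn_tSlot₂ hj) h
            (hj.2.1.trans hj.2.2)
  have h3 : Uses (serial ((List.range N).flatMap fun i => invGates ((G i).up f)))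
      0 (∑ i ∈ Finset.range N, ((G i).c - (G i).b)) 0 0 0 0 := by
    have := Uses.serial_cnot (k := k)
      (l := (List.range N).flatMap fun i => invGates ((G i).up f)) ?_
    · rw [length_flatMap_range] at this
      simpa [length_invGates, Gadget.up] using this
    · intro g hg
      obtain ⟨i, hi, hg⟩ := List.mem_flatMap.mp hg
      exact (Gadget.isNearCNOTs_up hf (hG.valid i (List.mem_range.mp hi))).inv g hg
  have h4 : Uses [(List.range N).flatMap fun i => [Gate.h (f (G i).b)]] 0 0 0 0 N 1 := by
    have := Uses.slot_H (k := k)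
      (s := (List.range N).flatMap fun i => [Gate.h (f (G i).b)]) ?_ ?_
    · rw [length_flatMap_range] at this
      simpa using this
    · intro g hg
      obtain ⟨i, _, hg⟩ := List.mem_flatMap.mp hg
      obtain rfl := List.mem_singleton.mp hg
      rfl
    · rw [List.pairwise_flatMap]
      constructor
      · exact fun i _ => List.pairwise_singleton _ _
      · exact hG.pairwise fun i j hi hj h =>
          (actsOn_singleton (g := Gate.h (f (G i).b)) rfl le_rfl hi.1.le).disjoint hf
            (actsOn_singleton (g := Gate.h (f (G j).b)) rfl le_rfl hj.1.le) h
            (hj.2.1.trans hj.2.2)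
  have h := ((h1.append h2).append h3).append h4
  have e : ∑ i ∈ Finset.range N, (2 * ((G i).a - (G i).b) + 1) =
      ∑ i ∈ Finset.range N, ((G i).c - (G i).b + (2 * ((G i).a - (G i).c) + 1)) +
        ∑ i ∈ Finset.range N, ((G i).c - (G i).b) := by
    rw [← Finset.sum_add_distrib]
    refine Finset.sum_congr rfl fun i hi => ?_
    obtain ⟨h5, h6, h7⟩ := hG.valid i (Finset.mem_range.mp hi)
    omega
  have e2 : 4 * N = 2 * N + 2 * N := by ring
  have e3 : 2 * N = N + N := by ring
  rw [e, e2]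
  nth_rw 3 [e3]
  simpa [staircase] using h

/-- A qubit that none of the first `N` gadgets changes. -/
theorem staircaseFlow_of_forall {f : ℕ → Fin k} {G : ℕ → Gadget} {N : ℕ} {q : Fin k}
    (hq : ∀ i < N, q ≠ f (G i).b ∧ q ∉ (G i).side f) (y : Basis k) :
    staircaseFlow f G N y q = y q := by
  induction N with
  | zero => rfl
  | succ N ih =>
    rw [staircaseFlow, Function.comp_apply, Gadget.gflow_of_notMem (hq N (by omega)).1
      (hq N (by omega)).2, ih fun i hi => hq i (by omega)]

/-- The target of the gadget `i`, if no other gadget interferes. -/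
theorem staircaseFlow_b {f : ℕ → Fin k} {G : ℕ → Gadget} {N i : ℕ} (hi : i < N)
    (hb : ∀ j < N, j ≠ i → f (G i).b ≠ f (G j).b ∧ f (G i).b ∉ (G j).side f)
    (hc : ∀ j < i, f (G i).c ≠ f (G j).b ∧ f (G i).c ∉ (G j).side f)
    (ha : ∀ j < i, f (G i).a ≠ f (G j).b ∧ f (G i).a ∉ (G j).side f) (y : Basis k) :
    staircaseFlow f G N y (f (G i).b) = y (f (G i).b) + (G i).fires f y := by
  induction N with
  | zero => omega
  | succ N ih =>
    rw [staircaseFlow, Function.comp_apply]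
    rcases Nat.lt_or_ge i N with h | h
    · rw [Gadget.gflow_of_notMem (hb N (by omega) (by omega)).1 (hb N (by omega) (by omega)).2]
      exact ih h fun j hj => hb j (by omega)
    · obtain rfl : i = N := by omega
      rw [Gadget.gflow_b, staircaseFlow_of_forall fun j hj => hb j (by omega) (by omega)]
      congr 1
      rw [Gadget.fires, Gadget.fires, staircaseFlow_of_forall hc, staircaseFlow_of_forall ha]

theorem staircaseFlow_flip {f : ℕ → Fin k} {G : ℕ → Gadget} {N : ℕ} {t : Fin k}
    (ht : ∀ i < N, t ≠ f (G i).b ∧ t ≠ f (G i).c ∧ t ≠ f (G i).a) (y : Basis k) :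
    staircaseFlow f G N (flip t y) = flip t (staircaseFlow f G N y) := by
  induction N with
  | zero => rfl
  | succ N ih =>
    obtain ⟨h1, h2, h3⟩ := ht N (by omega)
    rw [staircaseFlow, Function.comp_apply, ih fun i hi => ht i (by omega),
      Gadget.gflow_flip h1 h2 h3]
    rfl

/-! ### Diagonal circuits -/

theorem fromRight_eq_fromLeft [NeZero k] {i : ℕ} (h : i < k) :
    (fromRight (k - 1 - i) : Fin k) = fromLeft i := by
  apply Fin.ext
  rw [val_fromRight, val_fromLeft h]
  omega

theorem fromLeft_ne_fromRight [NeZero k] {i j : ℕ} (h : i + j + 1 < k) :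
    (fromLeft i : Fin k) ≠ fromRight j := by
  intro e
  have := congrArg Fin.val e
  rw [val_fromLeft (by omega), val_fromRight] at this
  omega

/-- The parity of the first `p` and the last `q` bits. -/
def outerParity [NeZero k] (p q : ℕ) (y : Basis k) : Fin 2 :=
  ∑ i ∈ Finset.range p, y (fromLeft i) + ∑ i ∈ Finset.range q, y (fromRight i)

theorem outerParity_flip [NeZero k] {p q : ℕ} (h : p + q ≤ k) {t : Fin k}
    (ht : t.val < p ∨ k ≤ t.val + q) (y : Basis k) :
    outerParity p q (flip t y) = outerParity p q y + 1 := by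
  have hk := t.isLt
  unfold outerParity
  rcases ht with ht | ht
  · have h1 := sum_flip_of_mem (isPath_fromLeft (k := k)) (b := 0) (p := p) (by omega) ht y
    have h2 := sum_flip_of_notMem (fromRight (k := k)) (b := 0) (p := q) (t := t)
      (by
        intro i hi e
        have := congrArg Fin.val e
        rw [val_fromRight] at this
        omega) y
    simp only [zero_add, fromLeft_val] at h1 h2
    rw [h1, h2]
    abel
  · have h1 := sum_flip_of_mem (isPath_fromRight (k := k)) (b := 0) (p := q) (by omega)
      (show k - 1 - t.val < q by omega) y
    have h2 := sum_flip_of_notMem (fromLeft (k := k)) (b := 0) (p := p) (t := t)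
      (by
        intro i hi e
        have := congrArg Fin.val e
        rw [val_fromLeft (by omega)] at this
        omega) y
    simp only [zero_add, fromRight_eq_fromLeft hk, fromLeft_val] at h1 h2
    rw [h1, h2]
    abel

theorem outerParity_update [NeZero k] {p q i : ℕ} (h1 : p ≤ i) (h2 : i + q < k) (y : Basis k)
    (s : Fin 2) : outerParity p q (Function.update y (fromLeft i) s) = outerParity p q y := by
  unfold outerParity
  congr 1 <;> refine Finset.sum_congr rfl fun j hj => ?_ <;> rw [Finset.mem_range] at hj
  · rw [Function.update_of_ne (isPath_fromLeft.ne (by omega) (by omega) (by omega))]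
  · rw [Function.update_of_ne (fromLeft_ne_fromRight (by omega)).symm]

/-- The circuit that attaches the sign `-1` if the bit at the position `z` and the parity of all
other bits are `1`. -/
def signCircuit [NeZero k] (z : ℕ) : Circuit k :=
  [[.h (fromLeft z)]] ++ serial (sumInto fromLeft z ++ sumInto fromRight (k - 1 - z)) ++
    [[.h (fromLeft z)]]

theorem uses_signCircuit [NeZero k] {z : ℕ} (h : z + 1 < k) :
    Uses (signCircuit z : Circuit k) 0 (2 * k - 3) 0 0 2 2 := by
  have h1 : Uses [[Gate.h (fromLeft z : Fin k)]] 0 0 0 0 1 1 :=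
    Uses.slot_H (by simp [Gate.isH]) (List.pairwise_singleton _ _)
  have h2 := Uses.serial_cnot ((isNearCNOTs_sumInto (isPath_fromLeft (k := k))
    (p := z) (by omega)).append
    (isNearCNOTs_sumInto (isPath_fromRight (k := k)) (p := k - 1 - z) (by omega)))
  have h3 := (h1.append h2).append h1
  have e : (sumInto (fromLeft (k := k)) z ++ sumInto (fromRight (k := k)) (k - 1 - z)).length ≤
      2 * k - 3 := by
    simp only [sumInto, List.length_append, length_invGates, length_ladder]
    omega
  exact ⟨h3.lnn, h3.rot, h3.cnot.trans (by omega), h3.cnotDepth.trans (by omega), h3.t, h3.tDepth,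
    h3.h, h3.hDepth⟩

theorem toOp_signCircuit [NeZero k] {z : ℕ} (h : z + 1 < k) :
    ∃ α : Basis k → ℂ, (signCircuit z : Circuit k).toOp = mono id α ∧ (∀ y, α y * α y = 1) ∧
      ∀ t : Fin k, t ≠ fromLeft z → ∀ y,
        α (flip t y) = (if y (fromLeft z) = 1 then -1 else 1) * α y := by
  set b : Fin k := fromLeft z with hb
  have hn1 := isNearCNOTs_sumInto (isPath_fromLeft (k := k)) (p := z) (by omega)
  have hn2 := isNearCNOTs_sumInto (isPath_fromRight (k := k)) (p := k - 1 - z) (by omega)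
  have hn := hn1.append hn2
  let e : Basis k → Fin 2 := outerParity z (k - 1 - z)
  have he : ∀ y s, e (Function.update y b s) = e y := fun y s =>
    outerParity_update le_rfl (by omega) y s
  have hflow : flowL (sumInto fromLeft z ++ sumInto fromRight (k - 1 - z)) =
      fun y : Basis k => Function.update y b (y b + e y) := by
    funext y
    rw [flowL_append, flowL_sumInto isPath_fromLeft (by omega),
      flowL_sumInto isPath_fromRight (by omega), fromRight_eq_fromLeft (by omega), ← hb,
      Function.update_self, Function.update_idem, add_assoc]
    congr 3
    refine Finset.sum_congr rfl fun i hi => ?_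
    rw [Finset.mem_range] at hi
    rw [Function.update_of_ne (fromLeft_ne_fromRight (by omega)).symm]
  have hc := hadamard_conj_mono (b := b) (π := fun y => Function.update y b (y b + e y))
    (φ := fun _ => 1) e (fun _ => 0)
    (by intro y s j hj; rw [Function.update_of_ne hj, Function.update_of_ne hj,
          Function.update_of_ne hj])
    (fun y => Function.update_self ..) he (by simp)
  refine ⟨fun y => if y b = 1 ∧ e y = 1 then -1 else 1, ?_, ?_, ?_⟩
  · have e1 : (signCircuit z : Circuit k).toOp = (Gate.h b).toOp *
        seqOp (sumInto fromLeft z ++ sumInto fromRight (k - 1 - z)) * (Gate.h b).toOp := by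
      rw [signCircuit, toOp_append, toOp_append, toOp_serial, ← mul_assoc]
      simp [Circuit.toOp, hb]
    have e2 : phL (sumInto fromLeft z ++ sumInto fromRight (k - 1 - z)) =
        fun _ : Basis k => (1 : ℂ) := funext fun y => phL_cnot hn.isCNOT y
    rw [e1, seqOp_eq_mono hn.classical, hflow, e2, hc]
    congr 1
    · funext y
      simp
    · simp
  · intro y
    beta_reduce
    split_ifs <;> norm_num
  · intro t ht y
    have e1 : e (flip t y) = e y + 1 := by
      apply outerParity_flip (by omega)
      have : t.val ≠ z := fun e => ht (by rw [hb, ← e, fromLeft_val])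
      omega
    have hb2 : ∀ b : Fin 2, b = 0 ∨ b = 1 := by decide
    beta_reduce
    rw [e1, flip_of_ne ht.symm]
    rcases hb2 (y b) with h | h <;> rcases hb2 (e y) with h' | h' <;> simp [h, h']

/-- CNOT gates that collect at the position `z₁ + 1` the parity of all bits, but leave the bits at
the positions `z₀ < z₁` as they are. -/
def collect [NeZero k] (z₀ z₁ : ℕ) : List (Gate k) :=
  ladder fromRight 0 (k - 1 - (z₁ + 1)) ++ ladder fromLeft 0 (z₁ + 1) ++
    [.cnot (fromLeft (z₁ - 1)) (fromLeft z₁)] ++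
    if z₀ = 0 then [] else [.cnot (fromLeft (z₀ - 1)) (fromLeft z₀)]

theorem isNearCNOTs_collect [NeZero k] {z₀ z₁ : ℕ} (h1 : z₀ < z₁) (h2 : z₁ + 1 < k) :
    IsNearCNOTs (collect z₀ z₁ : List (Gate k)) := by
  have h : ∀ i, 0 < i → i < k → IsNearCNOTs [Gate.cnot (fromLeft (i - 1) : Fin k) (fromLeft i)] := by
    intro i h3 h4 g hg
    obtain rfl := List.mem_singleton.mp hg
    have := isPath_fromLeft.adj (k := k) (i - 1) (by omega)
    rw [Nat.sub_add_cancel h3] at this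
    exact ⟨rfl, this⟩
  refine (((isNearCNOTs_ladder isPath_fromRight (by omega)).append
    (isNearCNOTs_ladder isPath_fromLeft (by omega))).append (h z₁ (by omega) (by omega))).append ?_
  split_ifs
  · exact isNearCNOTs_nil
  · exact h z₀ (by omega) (by omega)

theorem length_collect_le [NeZero k] {z₀ z₁ : ℕ} (h2 : z₁ + 1 < k) :
    (collect z₀ z₁ : List (Gate k)).length ≤ k + 1 := by
  rw [collect]
  split_ifs <;> simp <;> omega

theorem flowL_collect [NeZero k] {z₀ z₁ : ℕ} (h1 : z₀ < z₁) (h2 : z₁ + 1 < k) (y : Basis k) :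
    flowL (collect z₀ z₁) y (fromLeft (z₁ + 1)) = outerParity (z₁ + 1) (k - (z₁ + 1)) y ∧
    flowL (collect z₀ z₁) y (fromLeft z₁) = y (fromLeft z₁) ∧
    flowL (collect z₀ z₁) y (fromLeft z₀) = y (fromLeft z₀) := by
  have hL := isPath_fromLeft (k := k)
  obtain ⟨y₁, hy₁⟩ : ∃ y₁, flowL (ladder fromRight 0 (k - 1 - (z₁ + 1))) y = y₁ := ⟨_, rfl⟩
  obtain ⟨y₂, hy₂⟩ : ∃ y₂, flowL (ladder fromLeft 0 (z₁ + 1)) y₁ = y₂ := ⟨_, rfl⟩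
  -- The first ladder sums up the right part in `z₁ + 1`, the second one adds the left part to it;
  -- the last gates undo the prefix sums at `z₁` and `z₀`.
  have f1 : ∀ i ≤ z₁, y₁ (fromLeft i) = y (fromLeft i) := by
    intro i hi
    rw [← hy₁]
    exact flowL_ladder_of_forall_ne _ _ _ _ fun j hj => fromLeft_ne_fromRight (by omega)
  have f2 : y₁ (fromLeft (z₁ + 1)) = ∑ i ∈ Finset.range (k - (z₁ + 1)), y (fromRight i) := by
    have := flowL_ladder (isPath_fromRight (k := k)) (b := 0) (p := k - 1 - (z₁ + 1)) (by omega) y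
      le_rfl
    simp only [zero_add, fromRight_eq_fromLeft h2] at this
    rw [hy₁, show k - 1 - (z₁ + 1) + 1 = k - (z₁ + 1) by omega] at this
    exact this
  have f3 : ∀ j ≤ z₁ + 1, y₂ (fromLeft j) = ∑ i ∈ Finset.range (j + 1), y₁ (fromLeft i) := by
    intro j hj
    have := flowL_ladder hL (b := 0) (p := z₁ + 1) (by omega) y₁ hj
    simp only [zero_add] at this
    rw [← hy₂, this]
  have f4 : ∀ j ≤ z₁, y₂ (fromLeft j) = ∑ i ∈ Finset.range (j + 1), y (fromLeft i) := by
    intro j hj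
    rw [f3 j (by omega)]
    exact Finset.sum_congr rfl fun i hi => f1 i (by rw [Finset.mem_range] at hi; omega)
  have f5 : ∀ j ≤ z₁, 0 < j → y₂ (fromLeft j) + y₂ (fromLeft (j - 1)) = y (fromLeft j) := by
    intro j hj hj0
    rw [f4 j hj, f4 (j - 1) (by omega), Finset.sum_range_succ, Nat.sub_add_cancel hj0]
    generalize ∑ i ∈ Finset.range j, y (fromLeft i) = u
    generalize y (fromLeft j) = v
    revert u v
    decide
  have f6 : y₂ (fromLeft (z₁ + 1)) = outerParity (z₁ + 1) (k - (z₁ + 1)) y := by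
    rw [f3 _ le_rfl, Finset.sum_range_succ, f2, outerParity]
    congr 1
    exact Finset.sum_congr rfl fun i hi => f1 i (by rw [Finset.mem_range] at hi; omega)
  have n1 : (fromLeft (z₁ + 1) : Fin k) ≠ fromLeft z₁ := hL.ne (by omega) (by omega) (by omega)
  have n2 : (fromLeft z₀ : Fin k) ≠ fromLeft z₁ := hL.ne (by omega) (by omega) (by omega)
  have n3 : (fromLeft (z₁ + 1) : Fin k) ≠ fromLeft z₀ := hL.ne (by omega) (by omega) (by omega)
  have e : flowL (collect z₀ z₁) y =
      flowL (if z₀ = 0 then [] else [.cnot (fromLeft (z₀ - 1)) (fromLeft z₀)])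
        (Function.update y₂ (fromLeft z₁) (y₂ (fromLeft z₁) + y₂ (fromLeft (z₁ - 1)))) := by
    rw [collect, flowL_append, flowL_append, flowL_append, hy₁, hy₂]
    rfl
  rw [e, f5 z₁ le_rfl (by omega)]
  by_cases h0 : z₀ = 0
  · subst h0
    simp only [if_true, flowL]
    rw [Function.update_of_ne n1, Function.update_self, Function.update_of_ne n2, f4 0 (by omega)]
    exact ⟨f6, rfl, by simp⟩
  · have n4 : (fromLeft (z₀ - 1) : Fin k) ≠ fromLeft z₁ :=
      hL.ne (by omega) (by omega) (by omega)
    simp only [if_neg h0, flowL, Gate.flow]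
    rw [Function.update_self, Function.update_of_ne n3, Function.update_of_ne n1,
      Function.update_of_ne n2.symm, Function.update_self, Function.update_of_ne n2,
      Function.update_of_ne n4, f5 z₀ (by omega) (by omega)]
    exact ⟨f6, rfl, rfl⟩

/-- The gadget, on the line enumerated from the right, whose inner part attaches the phases of
`midCircuit`. -/
def midGadget (k z₀ z₁ : ℕ) : Gadget := ⟨k - 1 - (z₁ + 1), k - 1 - z₁, k - 1 - z₀, 0, 0⟩

/-- The diagonal circuit that attaches phases depending on the total parity and on the bits at the
positions `z₀` and `z₁`. -/
def midCircuit [NeZero k] (z₀ z₁ : ℕ) : Circuit k :=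
  let g := midGadget k z₀ z₁
  let P := collect z₀ z₁ ++ g.up fromRight
  let Q := g.across fromRight
  serial P ++ [tSlot₁ fromRight (g.c - 1) g.κc] ++ serial Q ++
    [tSlot₂ fromRight (g.c - 1) g.κc g.κa] ++ serial (invGates Q ++ invGates P)

theorem midGadget_valid {z₀ z₁ : ℕ} (h1 : z₀ < z₁) (h2 : z₁ + 1 < k) :
    (midGadget k z₀ z₁).Valid k := by
  refine ⟨?_, ?_, ?_⟩ <;> simp only [midGadget] <;> omega

theorem uses_midCircuit [NeZero k] {z₀ z₁ : ℕ} (h1 : z₀ < z₁) (h2 : z₁ + 1 < k) :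
    Uses (midCircuit z₀ z₁ : Circuit k) 0 (2 * k + 6 + 4 * (z₁ - z₀)) 4 2 0 0 := by
  have hv := midGadget_valid h1 h2
  have hR := isPath_fromRight (k := k)
  have hP := (isNearCNOTs_collect h1 h2).append (Gadget.isNearCNOTs_up hR hv)
  have hQ := Gadget.isNearCNOTs_across hR hv
  have hc : (midGadget k z₀ z₁).c - 1 + 1 < k := by simp only [midGadget]; omega
  have h := ((((Uses.serial_cnot hP).append (Uses.slot_T (isT_tSlot₁ fromRight
    ((midGadget k z₀ z₁).c - 1) (midGadget k z₀ z₁).κc) (pairwise_tGates hR hc _ _))).append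
    (Uses.serial_cnot hQ)).append (Uses.slot_T (isT_tSlot₂ fromRight
    ((midGadget k z₀ z₁).c - 1) (midGadget k z₀ z₁).κc (midGadget k z₀ z₁).κa)
    (pairwise_tGates hR hc _ _))).append
    (Uses.serial_cnot (hQ.inv.append hP.inv))
  have e1 := length_collect_le (k := k) (z₀ := z₀) h2
  have e2 : ((midGadget k z₀ z₁).up (fromRight (k := k))).length = 1 := by
    simp only [Gadget.up, length_ladder, midGadget]; omega
  have e3 : ((midGadget k z₀ z₁).across (fromRight (k := k))).length = 2 * (z₁ - z₀) + 1 := by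
    simp only [Gadget.across, length_spread, midGadget]; omega
  simp only [List.length_append, length_invGates, e2, e3] at h
  exact ⟨h.lnn, h.rot, h.cnot.trans (by omega), h.cnotDepth.trans (by omega), h.t, h.tDepth,
    h.h, h.hDepth⟩

theorem toOp_midCircuit [NeZero k] {z₀ z₁ : ℕ} (h1 : z₀ < z₁) (h2 : z₁ + 1 < k) :
    ∃ μ : Basis k → ℂ, (midCircuit z₀ z₁ : Circuit k).toOp = mono id μ ∧
      ∀ t : Fin k, t ≠ fromLeft z₀ → t ≠ fromLeft z₁ → ∀ y, μ (flip t y) =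
        (if y (fromLeft z₀) = 0 ∧ y (fromLeft z₁) = 0 then -1 else 1) * μ y := by
  have hv := midGadget_valid h1 h2
  have hR := isPath_fromRight (k := k)
  have hP := (isNearCNOTs_collect h1 h2).append (Gadget.isNearCNOTs_up hR hv)
  have hQ := Gadget.isNearCNOTs_across hR hv
  set g := midGadget k z₀ z₁ with hg
  have hgb : g.b = k - 1 - (z₁ + 1) := rfl
  have hgc : g.c = k - 1 - z₁ := rfl
  have hga : g.a = k - 1 - z₀ := rfl
  have hflat : (midCircuit z₀ z₁ : Circuit k).flatten =
      (collect z₀ z₁ ++ g.up fromRight) ++ tSlot₁ fromRight (g.c - 1) g.κc ++ g.across fromRight ++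
      tSlot₂ fromRight (g.c - 1) g.κc g.κa ++
      (invGates (g.across fromRight) ++ invGates (collect z₀ z₁ ++ g.up fromRight)) := by
    simp only [midCircuit, List.flatten_append, flatten_serial, List.flatten_singleton]
    rfl
  have hcl : ∀ x ∈ (midCircuit z₀ z₁ : Circuit k).flatten, x.Classical := by
    rw [hflat]
    exact classical_sandwich hP.classical hQ.classical (hQ.inv.append hP.inv).classical _ _ _ _
  have hflow : flowL (midCircuit z₀ z₁ : Circuit k).flatten = id := by
    funext y
    rw [hflat, flowL_sandwich, flowL_append, flowL_invGates hQ.classical,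
      flowL_invGates hP.classical, id]
  refine ⟨phL (midCircuit z₀ z₁ : Circuit k).flatten, ?_, ?_⟩
  · rw [Circuit.toOp, seqOp_eq_mono hcl, hflow]
  · have key : ∀ y, phL (midCircuit z₀ z₁ : Circuit k).flatten y =
        fourPhase 0 0 (outerParity (z₁ + 1) (k - (z₁ + 1)) y) (y (fromLeft z₁))
          (y (fromLeft z₀)) := by
      intro y
      rw [hflat, phL_sandwich hP.isCNOT hQ.isCNOT (hQ.inv.append hP.inv).isCNOT, flowL_append,
        Gadget.phL_slots hR hv]
      obtain ⟨c1, c2, c3⟩ := flowL_collect h1 h2 y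
      rw [show g.c - g.b = 1 by omega, Finset.sum_range_one, add_zero, hgb, hgc, hga,
        fromRight_eq_fromLeft h2, fromRight_eq_fromLeft (by omega),
        fromRight_eq_fromLeft (by omega), c1, c2, c3]
      rfl
    intro t ht0 ht1 y
    rw [key, key, outerParity_flip (by omega) (by have := t.isLt; omega), flip_of_ne ht0.symm,
      flip_of_ne ht1.symm, fourPhase_add_one]
    simp only [and_comm]

/-! ### Computing the conjunction of the controls -/

theorem toggle_eq_zero (p : Prop) [Decidable p] : (1 + if p then 1 else 0 : Fin 2) = 0 ↔ p := by
  by_cases h : p <;> simp [h]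

theorem eq_zero_iff_of_toggle {p : Prop} [Decidable p] {y : Fin 2}
    (h : (1 : Fin 2) = y + if p then 1 else 0) : y = 0 ↔ p := by
  revert h
  by_cases hp : p <;> simp only [hp, if_true, if_false] <;> revert y <;> decide

/-- The index of the second control of the gadget `i` of the second staircase. -/
def farIndex (M ε i : ℕ) : ℕ := if i < M then 2 * i + 3 else 2 * M + 5 - ε

/-- The value for which the second control of the gadget `i` of the second staircase fires. -/
def farValue (M ε i : ℕ) : Fin 2 := if i < M then 0 else if ε = 0 then 1 else 0

/-- The logic behind the two staircases.  The bits `x` are sent by the first staircase to `o`, and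
`y` by the second one to `o`.  In terms of `y`, the conjunction of all the bits of `x` can be read
from the first two bits, provided that `x 0 = 1`: going down, `y (2 * j) = 0` says that
`x (2 * j + 1)` and `x (2 * j + 2)` are `1`, and then `y (2 * j + 1) = 0` says that
`y (2 * j + 2)` and `y (2 * j + 3)` are `0`. -/
theorem conjunction_iff {M ε : ℕ} (hε : ε ≤ 1) {x o y : ℕ → Fin 2}
    (h1 : ∀ i < M + 2 + ε,
      o (2 * i) = x (2 * i) + if x (2 * i + 1) = 1 ∧ x (2 * i + 2) = 1 then 1 else 0)
    (h2 : ∀ i < M + 3, o (2 * i + 1) = x (2 * i + 1))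
    (h3 : ∀ i ≤ M, o (2 * i + 1) = y (2 * i + 1) +
      if y (2 * i + 2) = 0 ∧ y (farIndex M ε i) = farValue M ε i then 1 else 0)
    (h4 : ∀ i ≤ M + 1, y (2 * i) = o (2 * i))
    (h5 : y (farIndex M ε M) = o (farIndex M ε M)) (h0 : x 0 = 1) :
    (y 0 = 0 ∧ y 1 = 0) ↔ ∀ i < 2 * M + 6 + ε, x i = 1 := by
  have even : ∀ j ≤ M + 1, x (2 * j) = 1 →
      (y (2 * j) = 0 ↔ x (2 * j + 1) = 1 ∧ x (2 * j + 2) = 1) := by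
    intro j hj hx
    rw [h4 j hj, h1 j (by omega), hx, toggle_eq_zero]
  have odd : ∀ j ≤ M, x (2 * j + 1) = 1 → (y (2 * j + 1) = 0 ↔
      y (2 * j + 2) = 0 ∧ y (farIndex M ε j) = farValue M ε j) := by
    intro j hj hx
    have := h3 j hj
    rw [h2 j (by omega), hx] at this
    exact eq_zero_iff_of_toggle this
  have far : x (2 * M + 4) = 1 → (y (farIndex M ε M) = farValue M ε M ↔
      ∀ i, 2 * M + 5 ≤ i → i < 2 * M + 6 + ε → x i = 1) := by
    intro hx
    rw [h5]
    have e : ε = 0 ∨ ε = 1 := by omega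
    rcases e with rfl | rfl
    · have e1 : farIndex M 0 M = 2 * (M + 2) + 1 := by simp [farIndex]; omega
      have e2 : farValue M 0 M = 1 := by simp [farValue]
      rw [e1, e2, h2 _ (by omega)]
      constructor
      · intro h i h6 h7
        rwa [show i = 2 * (M + 2) + 1 by omega]
      · exact fun h => h _ (by omega) (by omega)
    · have e1 : farIndex M 1 M = 2 * (M + 2) := by simp [farIndex]; omega
      have e2 : farValue M 1 M = 0 := by simp [farValue]
      rw [e1, e2, h1 _ (by omega), show 2 * (M + 2) = 2 * M + 4 by omega, hx, toggle_eq_zero]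
      constructor
      · rintro ⟨h6, h7⟩ i h8 h9
        have : i = 2 * M + 4 + 1 ∨ i = 2 * M + 4 + 2 := by omega
        rcases this with rfl | rfl
        exacts [h6, h7]
      · exact fun h => ⟨h _ (by omega) (by omega), h _ (by omega) (by omega)⟩
  have main : ∀ d ≤ M, x (2 * (M - d)) = 1 →
      ((y (2 * (M - d)) = 0 ∧ y (2 * (M - d) + 1) = 0) ↔
        ∀ i, 2 * (M - d) < i → i < 2 * M + 6 + ε → x i = 1) := by
    intro d
    induction d with
    | zero =>
      intro _ hx
      rw [Nat.sub_zero] at hx ⊢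
      constructor
      · rintro ⟨h6, h7⟩
        obtain ⟨h8, h9⟩ := (even M (by omega) hx).mp h6
        obtain ⟨h10, h11⟩ := (odd M le_rfl h8).mp h7
        obtain ⟨h12, h13⟩ := (even (M + 1) le_rfl h9).mp h10
        have h14 := (far h13).mp h11
        intro i hi hi'
        rcases Nat.lt_or_ge i (2 * M + 5) with h | h
        · have : i = 2 * M + 1 ∨ i = 2 * M + 2 ∨ i = 2 * (M + 1) + 1 ∨ i = 2 * (M + 1) + 2 := by
            omega
          rcases this with rfl | rfl | rfl | rfl
          exacts [h8, h9, h12, h13]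
        · exact h14 i h hi'
      · intro h
        have h9 : x (2 * (M + 1)) = 1 := h _ (by omega) (by omega)
        refine ⟨(even M (by omega) hx).mpr ⟨h _ (by omega) (by omega), h9⟩,
          (odd M le_rfl (h _ (by omega) (by omega))).mpr
            ⟨(even (M + 1) le_rfl h9).mpr ⟨h _ (by omega) (by omega), h _ (by omega) (by omega)⟩,
              (far (h _ (by omega) (by omega))).mpr fun i h6 h7 => h i (by omega) h7⟩⟩
    | succ d ih =>
      intro hd hx
      have ih := ih (by omega)
      obtain ⟨j, hj⟩ : ∃ j, j = M - (d + 1) := ⟨_, rfl⟩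
      rw [show M - d = j + 1 by omega] at ih
      rw [← hj] at hx ⊢
      have e1 : farIndex M ε j = 2 * (j + 1) + 1 := by
        rw [farIndex, if_pos (by omega)]; omega
      have e2 : farValue M ε j = 0 := by rw [farValue, if_pos (by omega)]
      have odd' := odd j (by omega)
      rw [e1, e2] at odd'
      constructor
      · rintro ⟨h6, h7⟩
        obtain ⟨h8, h9⟩ := (even j (by omega) hx).mp h6
        have h10 := (ih h9).mp ((odd' h8).mp h7)
        intro i hi hi'
        have : i = 2 * j + 1 ∨ i = 2 * j + 2 ∨ 2 * (j + 1) < i := by omega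
        rcases this with rfl | rfl | h
        exacts [h8, h9, h10 i h hi']
      · intro h
        have h8 := h (2 * j + 1) (by omega) (by omega)
        have h9 := h (2 * j + 2) (by omega) (by omega)
        exact ⟨(even j (by omega) hx).mpr ⟨h8, h9⟩,
          (odd' h8).mpr ((ih h9).mpr fun i hi hi' => h i (by omega) hi')⟩
  have := main M le_rfl
  rw [Nat.sub_self, Nat.mul_zero, zero_add] at this
  rw [this h0]
  constructor
  · intro h i hi
    rcases Nat.eq_zero_or_pos i with rfl | hi0
    exacts [h0, h i hi0 hi]
  · exact fun h i _ hi => h i hi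

/-- The positions `z 0 < … < z (n - 1)` on a line of `k` qubits. -/
structure IsSorted (z : ℕ → ℕ) (n k : ℕ) : Prop where
  lt : ∀ i j, i < j → j < n → z i < z j
  bound : ∀ i < n, z i < k

theorem IsSorted.lt_iff {z : ℕ → ℕ} {n : ℕ} (hz : IsSorted z n k) {i j : ℕ} (hi : i < n)
    (hj : j < n) : z i < z j ↔ i < j := by
  refine ⟨fun h => ?_, fun h => hz.lt i j h hj⟩
  by_contra hc
  rcases Nat.eq_or_lt_of_not_lt hc with rfl | h'
  · omega
  · have := hz.lt j i h' hi
    omega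

theorem IsSorted.eq_iff {z : ℕ → ℕ} {n : ℕ} (hz : IsSorted z n k) {i j : ℕ} (hi : i < n)
    (hj : j < n) : z i = z j ↔ i = j := by
  refine ⟨fun h => ?_, fun h => by rw [h]⟩
  have h1 := hz.lt_iff hi hj
  have h2 := hz.lt_iff hj hi
  omega

theorem IsSorted.ne [NeZero k] {z : ℕ → ℕ} {n : ℕ} (hz : IsSorted z n k) {i j : ℕ} (hi : i < n)
    (hj : j < n) (hij : i ≠ j) : (fromLeft (z i) : Fin k) ≠ fromLeft (z j) :=
  isPath_fromLeft.ne (hz.bound i hi) (hz.bound j hj) fun h => hij ((hz.eq_iff hi hj).mp h)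

/-- The gadgets of the first staircase. -/
def gadget₁ (z : ℕ → ℕ) (i : ℕ) : Gadget := ⟨z (2 * i), z (2 * i + 1), z (2 * i + 2), 1, 1⟩

/-- The gadgets of the second staircase.  All of them but the last have as controls the next two
qubits. -/
def gadget₂ (z : ℕ → ℕ) (M ε : ℕ) (i : ℕ) : Gadget :=
  ⟨z (2 * i + 1), z (2 * i + 2), z (farIndex M ε i), 0, farValue M ε i⟩

section

variable {z : ℕ → ℕ} {M ε : ℕ}

theorem farIndex_bounds (hε : ε ≤ 1) {i : ℕ} (hi : i ≤ M) :
    2 * i + 2 < farIndex M ε i ∧ farIndex M ε i < 2 * M + 6 + ε ∧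
      ∀ j < i, farIndex M ε j = 2 * j + 3 := by
  refine ⟨?_, ?_, fun j hj => if_pos (by omega)⟩ <;> unfold farIndex <;> split_ifs <;> omega

theorem isStaircase_gadget₁ (hε : ε ≤ 1) (hz : IsSorted z (2 * M + 6 + ε) k) :
    IsStaircase (gadget₁ z) (M + 2 + ε) k where
  valid i hi := ⟨hz.lt _ _ (by omega) (by omega), hz.lt _ _ (by omega) (by omega),
    hz.bound _ (by omega)⟩
  lt i j hij hj := hz.lt _ _ (by omega) (by omega)

theorem isStaircase_gadget₂ (hε : ε ≤ 1) (hz : IsSorted z (2 * M + 6 + ε) k) :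
    IsStaircase (gadget₂ z M ε) (M + 1) k where
  valid i hi := by
    obtain ⟨h1, h2, -⟩ := farIndex_bounds (M := M) hε (i := i) (by omega)
    exact ⟨hz.lt _ _ (by omega) (by omega), hz.lt _ _ h1 h2, hz.bound _ h2⟩
  lt i j hij hj := hz.lt _ _ (by omega) (by omega)

theorem notMem_side_gadget₁ [NeZero k] (hε : ε ≤ 1) (hz : IsSorted z (2 * M + 6 + ε) k)
    {i j : ℕ} (hi : i < M + 2 + ε) (hj : j < 2 * M + 6 + ε) (hij : j ≠ 2 * i) :
    (fromLeft (z j) : Fin k) ≠ fromLeft (gadget₁ z i).b ∧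
      (fromLeft (z j) : Fin k) ∉ (gadget₁ z i).side fromLeft := by
  refine ⟨hz.ne hj (by omega) hij, ?_⟩
  have hv := (isStaircase_gadget₁ hε hz).valid i hi
  rw [Gadget.mem_side isPath_fromLeft hv (hz.bound j hj)]
  have e1 := hz.lt_iff hj (show 2 * i + 1 < 2 * M + 6 + ε by omega)
  have e2 := hz.lt_iff (show 2 * i < 2 * M + 6 + ε by omega) hj
  have e3 := hz.lt_iff hj (show 2 * i < 2 * M + 6 + ε by omega)
  have e4 := hz.lt_iff (show 2 * i + 1 < 2 * M + 6 + ε by omega) hj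
  have e5 := hz.lt_iff hj (show 2 * i + 2 < 2 * M + 6 + ε by omega)
  have e6 := hz.lt (2 * i) (2 * i + 1) (by omega) (by omega)
  simp only [gadget₁]
  omega

theorem notMem_side_gadget₂ [NeZero k] (hε : ε ≤ 1) (hz : IsSorted z (2 * M + 6 + ε) k)
    {i j : ℕ} (hi : i ≤ M) (hj : j < 2 * M + 6 + ε) (hij : j ≠ 2 * i + 1)
    (hij' : j ≤ 2 * i + 2 ∨ farIndex M ε i ≤ j) :
    (fromLeft (z j) : Fin k) ≠ fromLeft (gadget₂ z M ε i).b ∧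
      (fromLeft (z j) : Fin k) ∉ (gadget₂ z M ε i).side fromLeft := by
  refine ⟨hz.ne hj (by omega) hij, ?_⟩
  have hv := (isStaircase_gadget₂ hε hz).valid i (by omega)
  obtain ⟨h1, h2, -⟩ := farIndex_bounds (M := M) hε hi
  rw [Gadget.mem_side isPath_fromLeft hv (hz.bound j hj)]
  have e1 := hz.lt_iff hj (show 2 * i + 2 < 2 * M + 6 + ε by omega)
  have e2 := hz.lt_iff (show 2 * i + 1 < 2 * M + 6 + ε by omega) hj
  have e3 := hz.lt_iff hj (show 2 * i + 1 < 2 * M + 6 + ε by omega)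
  have e4 := hz.lt_iff (show 2 * i + 2 < 2 * M + 6 + ε by omega) hj
  have e5 := hz.lt_iff hj h2
  have e6 := hz.lt (2 * i + 1) (2 * i + 2) (by omega) (by omega)
  simp only [gadget₂]
  omega

theorem staircase_conjunction [NeZero k] (hε : ε ≤ 1) (hz : IsSorted z (2 * M + 6 + ε) k)
    {x y : Basis k} (hxy : staircaseFlow fromLeft (gadget₂ z M ε) (M + 1) y =
      staircaseFlow fromLeft (gadget₁ z) (M + 2 + ε) x) (h0 : x (fromLeft (z 0)) = 1) :
    (y (fromLeft (z 0)) = 0 ∧ y (fromLeft (z 1)) = 0) ↔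
      ∀ i < 2 * M + 6 + ε, x (fromLeft (z i)) = 1 := by
  set o := staircaseFlow fromLeft (gadget₁ z) (M + 2 + ε) x with ho
  obtain ⟨h6, h7, h8⟩ := farIndex_bounds (M := M) hε (le_refl M)
  refine conjunction_iff (x := fun i => x (fromLeft (z i))) (o := fun i => o (fromLeft (z i)))
    (y := fun i => y (fromLeft (z i))) hε ?_ ?_ ?_ ?_ ?_ h0
  · intro i hi
    exact staircaseFlow_b (G := gadget₁ z) hi
      (fun j hj hji => notMem_side_gadget₁ hε hz hj (by omega) (by omega))
      (fun j hj => notMem_side_gadget₁ hε hz (by omega) (by omega) (by omega))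
      (fun j hj => notMem_side_gadget₁ hε hz (by omega) (by omega) (by omega)) x
  · intro i hi
    exact staircaseFlow_of_forall
      (fun j hj => notMem_side_gadget₁ hε hz hj (by omega) (by omega)) x
  · intro i hi
    obtain ⟨h9, h10, h11⟩ := farIndex_bounds (M := M) hε hi
    rw [← hxy]
    refine staircaseFlow_b (G := gadget₂ z M ε) (show i < M + 1 by omega) (fun j hj hji => ?_)
      (fun j hj => ?_) (fun j hj => ?_) y
    · refine notMem_side_gadget₂ hε hz (by omega) (by omega) (by omega) ?_
      rcases Nat.lt_or_ge j i with h | h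
      · right; rw [h11 j h]; omega
      · left; omega
    · exact notMem_side_gadget₂ hε hz (by omega) (by omega) (by omega)
        (Or.inr (by rw [h11 j hj]; omega))
    · exact notMem_side_gadget₂ hε hz (by omega) (by omega) (by omega)
        (Or.inr (by rw [h11 j hj]; omega))
  · intro i hi
    rw [← hxy]
    refine (staircaseFlow_of_forall (fun j hj => ?_) y).symm
    refine notMem_side_gadget₂ hε hz (by omega) (by omega) (by omega) ?_
    rcases Nat.lt_or_ge j M with h | h
    · rw [h8 j h]; omega
    · left; omega
  · rw [← hxy]
    refine (staircaseFlow_of_forall (fun j hj => ?_) y).symm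
    have : farIndex M ε j ≤ farIndex M ε M := by
      rcases Nat.lt_or_ge j M with h | h
      · rw [h8 j h]; omega
      · rw [show j = M by omega]
    exact notMem_side_gadget₂ hε hz (by omega) (by omega) (by omega) (Or.inr this)

/-- The two staircases, the second one inverted. -/
def conjCircuit [NeZero k] (z : ℕ → ℕ) (M ε : ℕ) : Circuit k :=
  staircase fromLeft (gadget₁ z) (M + 2 + ε) ++
    inverse (staircase fromLeft (gadget₂ z M ε) (M + 1))

theorem uses_conjCircuit [NeZero k] (hε : ε ≤ 1) (hz : IsSorted z (2 * M + 6 + ε) k) :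
    Uses (conjCircuit z M ε : Circuit k) 0
      (4 * k - 6 - 2 * (z 0 + z 1) + (2 * M + 3 + ε)) (4 * (2 * M + 3 + ε)) (2 * M + 5 + ε)
      (2 * (2 * M + 3 + ε)) (2 * M + 5 + ε) := by
  have h := (uses_staircase (isPath_fromLeft (k := k)) (isStaircase_gadget₁ hε hz)).append
    (uses_staircase (isPath_fromLeft (k := k)) (isStaircase_gadget₂ hε hz)).inverse
  have s1 : ∀ N ≤ M + 2 + ε, ∑ i ∈ Finset.range N, (2 * ((gadget₁ z i).a - (gadget₁ z i).b) + 1) +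
      2 * z 0 = 2 * z (2 * N) + N := by
    intro N hN
    induction N with
    | zero => simp
    | succ N ih =>
      rw [Finset.sum_range_succ]
      have ih := ih (by omega)
      have : z (2 * N) < z (2 * N + 2) := hz.lt _ _ (by omega) (by omega)
      simp only [gadget₁] at ih ⊢
      rw [show 2 * (N + 1) = 2 * N + 2 by omega]
      omega
  have s2 : ∀ N ≤ M, ∑ i ∈ Finset.range N,
      (2 * ((gadget₂ z M ε i).a - (gadget₂ z M ε i).b) + 1) + 2 * z 1 =
        2 * z (2 * N + 1) + N := by
    intro N hN
    induction N with
    | zero => simp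
    | succ N ih =>
      rw [Finset.sum_range_succ]
      have ih := ih (by omega)
      have : z (2 * N + 1) < z (2 * N + 3) := hz.lt _ _ (by omega) (by omega)
      have e : farIndex M ε N = 2 * N + 3 := if_pos (by omega)
      simp only [gadget₂, e] at ih ⊢
      rw [show 2 * (N + 1) + 1 = 2 * N + 3 by omega]
      omega
  obtain ⟨h6, h7, -⟩ := farIndex_bounds (M := M) hε (le_refl M)
  have s3 : ∑ i ∈ Finset.range (M + 1),
      (2 * ((gadget₂ z M ε i).a - (gadget₂ z M ε i).b) + 1) + 2 * z 1 =
        2 * z (farIndex M ε M) + (M + 1) := by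
    rw [Finset.sum_range_succ]
    have s2 := s2 M le_rfl
    have : z (2 * M + 1) < z (farIndex M ε M) := hz.lt _ _ (by omega) (by omega)
    simp only [gadget₂] at s2 ⊢
    omega
  have s1 := s1 _ le_rfl
  -- The last controls of the two staircases are different qubits.
  have hlast : z (2 * (M + 2 + ε)) + z (farIndex M ε M) + 3 ≤ 2 * k := by
    have b1 := hz.bound (2 * (M + 2 + ε)) (by omega)
    have b2 := hz.bound (farIndex M ε M) h7
    have b3 : z (2 * (M + 2 + ε)) ≠ z (farIndex M ε M) := by
      rw [Ne, hz.eq_iff (by omega) h7]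
      rw [farIndex, if_neg (by omega)]
      omega
    omega
  refine ⟨h.lnn, h.rot, h.cnot.trans ?_, h.cnotDepth.trans ?_, h.t.trans ?_, h.tDepth.trans ?_,
    h.h.trans ?_, h.hDepth.trans ?_⟩ <;> omega

/-! ### Phases that test the conjunction of the controls -/

theorem injective_of_mul_mono_eq_one {N : Op k} {F : Basis k → Basis k} {φ : Basis k → ℂ}
    (h : N * mono F φ = 1) : Function.Injective F := by
  intro y y' hyy
  by_contra hne
  have h1 := congrFun (congrFun h y) y
  have h2 := congrFun (congrFun h y) y'
  have h3 := congrFun (congrFun h y') y'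
  rw [mul_mono, Matrix.one_apply_eq] at h1 h3
  rw [mul_mono, Matrix.one_apply_ne hne, ← hyy] at h2
  rcases mul_eq_zero.mp h2 with h2 | h2
  · rw [h2, zero_mul] at h1
    exact zero_ne_one h1
  · rw [h2, mul_zero] at h3
    exact zero_ne_one h3

/-- Conjugating a diagonal operator by a monomial operator permutes its entries; the phases of the
monomial operator drop out. -/
theorem mul_diagonal_mul_mono {N : Op k} {F : Basis k → Basis k} {φ : Basis k → ℂ}
    (h : N * mono F φ = 1) (ν : Basis k → ℂ) :
    N * mono id ν * mono F φ = mono id (ν ∘ F) := by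
  have : mono id ν * mono F φ = mono F φ * mono id (ν ∘ F) := by
    rw [mono_mul_mono, mono_mul_mono]
    congr 1
    funext y
    simp [mul_comm]
  rw [mul_assoc, this, ← mul_assoc, h, one_mul]

theorem mono_mul_diagonal_mul {N : Op k} {F σ : Basis k → Basis k} {φ : Basis k → ℂ}
    (h : N * mono F φ = 1) (hσ : ∀ y, σ (F y) = y) (ν : Basis k → ℂ) :
    mono F φ * mono id ν * N = mono id (ν ∘ σ) := by
  have : mono F φ * mono id ν = mono id (ν ∘ σ) * mono F φ := by
    rw [mono_mul_mono, mono_mul_mono]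
    congr 1
    funext y
    simp [hσ, mul_comm]
  rw [this, mul_assoc, mul_eq_one_comm.mp h, mul_one]

/-- The diagonal circuit whose phase tests, by way of the two staircases, the conjunction of the
controls. -/
def testCircuit [NeZero k] (z : ℕ → ℕ) (M ε : ℕ) : Circuit k :=
  conjCircuit z M ε ++ midCircuit (z 0) (z 1) ++ inverse (conjCircuit z M ε)

theorem IsSorted.succ_lt (hz : IsSorted z (2 * M + 6 + ε) k) : z 0 < z 1 ∧ z 1 + 1 < k := by
  have h1 := hz.lt 0 1 (by omega) (by omega)
  have h2 := hz.lt 1 2 (by omega) (by omega)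
  have h3 := hz.bound 2 (by omega)
  omega

theorem uses_testCircuit [NeZero k] (hε : ε ≤ 1) (hz : IsSorted z (2 * M + 6 + ε) k) :
    Uses (testCircuit z M ε : Circuit k) 0 (10 * k + 2 * (2 * M + 6 + ε) - 12)
      (8 * (2 * M + 3 + ε) + 4) (2 * (2 * M + 6 + ε)) (4 * (2 * M + 3 + ε))
      (2 * (2 * M + 5 + ε)) := by
  obtain ⟨h1, h2⟩ := hz.succ_lt
  have h3 := hz.lt 1 (2 * M + 5) (by omega) (by omega)
  have h4 := hz.bound (2 * M + 5) (by omega)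
  have hV := uses_conjCircuit hε hz
  have h := (hV.append (uses_midCircuit h1 h2)).append hV.inverse
  have hk : z 1 + 4 ≤ k := by
    have a1 := hz.lt 1 2 (by omega) (by omega)
    have a2 := hz.lt 2 3 (by omega) (by omega)
    have a3 := hz.lt 3 4 (by omega) (by omega)
    have a4 := hz.bound 4 (by omega)
    omega
  refine ⟨h.lnn, h.rot, h.cnot.trans ?_, h.cnotDepth.trans ?_, h.t.trans ?_, h.tDepth.trans ?_,
    h.h.trans ?_, h.hDepth.trans ?_⟩ <;> omega

/-- On the states in which the first control is `1`, the phase of the diagonal circuit changes sign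
with a bit outside of the controls exactly if all the controls are `1`. -/
theorem toOp_testCircuit [NeZero k] (hε : ε ≤ 1) (hz : IsSorted z (2 * M + 6 + ε) k) :
    ∃ (β : Basis k → ℂ) (p : Basis k → Prop), (testCircuit z M ε : Circuit k).toOp = mono id β ∧
      (∀ x, x (fromLeft (z 0)) = 1 → (p x ↔ ∀ i < 2 * M + 6 + ε, x (fromLeft (z i)) = 1)) ∧
      ∀ t : Fin k, (∀ i < 2 * M + 6 + ε, t ≠ fromLeft (z i)) →
        (∀ y, p (flip t y) ↔ p y) ∧
          ∀ y, (p y → β (flip t y) = -β y) ∧ (¬ p y → β (flip t y) = β y) := by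
  obtain ⟨h1, h2⟩ := hz.succ_lt
  have hG₁ := isStaircase_gadget₁ hε hz
  have hG₂ := isStaircase_gadget₂ hε hz
  obtain ⟨φ₁, hφ₁⟩ := toOp_staircase isPath_fromLeft hG₁
  obtain ⟨φ₂, hφ₂⟩ := toOp_staircase isPath_fromLeft hG₂
  obtain ⟨μ, hμ, hμ'⟩ := toOp_midCircuit h1 h2
  have l₁ := (uses_staircase isPath_fromLeft hG₁).lnn
  have l₂ := (uses_staircase isPath_fromLeft hG₂).lnn
  have i₁ := toOp_inverse_mul l₁
  have i₂ := toOp_inverse_mul l₂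
  set F₁ : Basis k → Basis k := staircaseFlow fromLeft (gadget₁ z) (M + 2 + ε) with hF₁
  set F₂ : Basis k → Basis k := staircaseFlow fromLeft (gadget₂ z M ε) (M + 1) with hF₂
  rw [hφ₁] at i₁
  rw [hφ₂] at i₂
  have inj₂ := injective_of_mul_mono_eq_one i₂
  have surj₂ := Finite.surjective_of_injective inj₂
  obtain ⟨σ, hσ⟩ := surj₂.hasRightInverse
  have hσ' : ∀ y, σ (F₂ y) = y := fun y => inj₂ (hσ _)
  have e : (testCircuit z M ε : Circuit k).toOp = mono id ((μ ∘ σ) ∘ F₁) := by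
    have lV := (uses_conjCircuit hε hz).lnn
    have hV : (conjCircuit z M ε : Circuit k).toOp =
        (inverse (staircase fromLeft (gadget₂ z M ε) (M + 1))).toOp * mono F₁ φ₁ := by
      rw [conjCircuit, toOp_append, hφ₁]
    have hV' : (inverse (conjCircuit z M ε : Circuit k)).toOp =
        (inverse (staircase fromLeft (gadget₁ z) (M + 2 + ε))).toOp * mono F₂ φ₂ := by
      refine left_inv_eq_right_inv (toOp_inverse_mul lV) ?_
      rw [hV]
      calc _ = (inverse (staircase fromLeft (gadget₂ z M ε) (M + 1))).toOp *
            (mono F₁ φ₁ * (inverse (staircase fromLeft (gadget₁ z) (M + 2 + ε))).toOp) *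
            mono F₂ φ₂ := by simp only [mul_assoc]
        _ = 1 := by rw [mul_eq_one_comm.mp i₁, mul_one, i₂]
    rw [testCircuit, toOp_append, toOp_append, hV, hV', hμ, ← mul_diagonal_mul_mono i₁,
      ← mono_mul_diagonal_mul i₂ hσ']
    simp only [mul_assoc]
  refine ⟨_, fun x => σ (F₁ x) (fromLeft (z 0)) = 0 ∧ σ (F₁ x) (fromLeft (z 1)) = 0, e, ?_, ?_⟩
  · intro x hx
    exact staircase_conjunction hε hz (hσ _) hx
  · -- The targets are none of the controls, so flipping a target commutes with both staircases.
    intro t ht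
    have f₁ : ∀ y, F₁ (flip t y) = flip t (F₁ y) := fun y => staircaseFlow_flip
      (fun i hi => ⟨ht _ (by omega), ht _ (by omega), ht _ (by omega)⟩) y
    have f₂ : ∀ y, F₂ (flip t y) = flip t (F₂ y) := fun y => staircaseFlow_flip
      (fun i hi => ⟨ht _ (by omega), ht _ (by omega),
        ht _ (farIndex_bounds hε (by omega)).2.1⟩) y
    have f₃ : ∀ y, σ (F₁ (flip t y)) = flip t (σ (F₁ y)) := by
      intro y
      apply inj₂
      rw [f₂, hσ, hσ, f₁]
    have t0 := ht 0 (by omega)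
    have t1 := ht 1 (by omega)
    constructor
    · intro y
      beta_reduce
      rw [f₃, flip_of_ne t0.symm, flip_of_ne t1.symm]
    · intro y
      simp only [Function.comp_apply, f₃]
      rw [hμ' t t0 t1]
      constructor
      · intro hp
        rw [if_pos hp, neg_one_mul]
      · intro hp
        rw [if_neg hp, one_mul]

end

/-! ### Rotations alternating with diagonal circuits -/

/-- A rotation `g (a t)` on every qubit `t` of the list `L`. -/
def layer (g : ℝ → Fin k → Gate k) (a : Fin k → ℝ) (L : List (Fin k)) : Circuit k :=
  serial (L.map fun t => g (a t) t)

theorem uses_layer {g : ℝ → Fin k → Gate k} (hg : ∀ a t, (g a t).isRotation = true)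
    (a : Fin k → ℝ) (L : List (Fin k)) : Uses (layer g a L) L.length 0 0 0 0 0 := by
  have := Uses.serial_rotation (l := L.map fun t => g (a t) t) (by simp [hg])
  rwa [List.length_map] at this

theorem toOp_layer_rx {T : Finset (Fin k)} {L : List (Fin k)} (hL : L.Nodup)
    (hT : ∀ t, t ∈ L ↔ t ∈ T) (a : Fin k → ℝ) :
    (layer .rx a L).toOp = blockOp T (fun _ => 1) fun _ i => rotX (a i) := by
  rw [layer, toOp_serial]
  exact seqOp_layer (fun t => rfl) hL hT

theorem toOp_layer_rz {T : Finset (Fin k)} {L : List (Fin k)} (hL : L.Nodup)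
    (hT : ∀ t, t ∈ L ↔ t ∈ T) (a : Fin k → ℝ) :
    (layer .rz a L).toOp = blockOp T (fun _ => 1) fun _ i => rotZ (a i) := by
  rw [layer, toOp_serial]
  exact seqOp_layer (fun t => rfl) hL hT

/-- The controls are the positions `z i`, and the targets are listed by `L`.  In time order, the
circuit is the inverse of `V`, then two rounds of rotations alternating with the diagonal circuits,
then `V`. -/
theorem exists_circuit [NeZero k] {z : ℕ → ℕ} {M ε : ℕ} (hε : ε ≤ 1)
    (hz : IsSorted z (2 * M + 6 + ε) k) {C : Finset (Fin k)}
    (hC : ∀ c, c ∈ C ↔ ∃ i < 2 * M + 6 + ε, c = fromLeft (z i)) {L : List (Fin k)}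
    (hL : L.Nodup) (hd : ∀ t ∈ L, t ∉ C) {W : Fin k → Matrix (Fin 2) (Fin 2) ℂ}
    (hW : ∀ t, W t ∈ Matrix.specialUnitaryGroup (Fin 2) ℂ) :
    ∃ c : Circuit k, Uses c (8 * L.length) (24 * k + 4 * (2 * M + 6 + ε) - 30)
        (16 * (2 * M + 6 + ε) - 40) (4 * (2 * M + 6 + ε)) (8 * (2 * M + 6 + ε) - 20)
        (4 * (2 * M + 6 + ε)) ∧
      c.toOp = (L.map fun t => controlled C t (W t)).prod := by
  classical
  obtain ⟨h1, h2⟩ := hz.succ_lt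
  choose b c θ hW using fun t => exists_eq_rotations (hW t)
  -- By `pauliZ_rotX_commutator`, rotations by `a` will combine to a rotation by `-4 * a = θ`.
  let a : Fin k → ℝ := fun t => -θ t / 4
  let A : Circuit k := signCircuit (z 0)
  let B : Circuit k := testCircuit z M ε
  have uA : Uses A 0 (2 * k - 3) 0 0 2 2 := uses_signCircuit (by omega)
  have uB := uses_testCircuit hε hz
  have uX := fun a => uses_layer (k := k) (g := .rx) (fun _ _ => rfl) a L
  have uZ := fun a => uses_layer (k := k) (g := .rz) (fun _ _ => rfl) a L
  refine ⟨layer .rx (fun t => -b t) L ++ (layer .rz (fun t => -c t) L ++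
    (layer .rx (fun t => -a t) L ++ (inverse B ++ (layer .rx a L ++ (A ++
    (layer .rx (fun t => -a t) L ++ (B ++ (layer .rx a L ++ (A ++
    (layer .rz c L ++ layer .rx b L)))))))))), ?_, ?_⟩
  · have h := (uX fun t => -b t).append ((uZ fun t => -c t).append
      ((uX fun t => -a t).append (uB.inverse.append ((uX a).append (uA.append
      ((uX fun t => -a t).append (uB.append ((uX a).append (uA.append
      ((uZ c).append (uX b)))))))))))
    have hk := hz.bound 5 (by omega)
    have a1 := hz.lt 1 2 (by omega) (by omega)
    have a2 := hz.lt 2 5 (by omega) (by omega)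
    refine ⟨h.lnn, h.rot.trans ?_, h.cnot.trans ?_, h.cnotDepth.trans ?_, h.t.trans ?_,
      h.tDepth.trans ?_, h.h.trans ?_, h.hDepth.trans ?_⟩ <;> omega
  · let T := L.toFinset
    have hT : ∀ t, t ∈ L ↔ t ∈ T := fun t => List.mem_toFinset.symm
    have hCT : Disjoint C T :=
      Finset.disjoint_right.mpr fun t ht => hd t ((hT t).mpr ht)
    have hz0 : fromLeft (z 0) ∈ C := (hC _).mpr ⟨0, by omega, rfl⟩
    obtain ⟨α, hα, hα1, hα2⟩ := toOp_signCircuit (k := k) (z := z 0) (by omega)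
    obtain ⟨β, p, hβ, hp, hβ2⟩ := toOp_testCircuit hε hz
    have hpC : ∀ r : Basis k, r (fromLeft (z 0)) = 1 → (p r ↔ ∀ c ∈ C, r c = 1) := by
      intro r hr
      rw [hp r hr]
      constructor
      · intro h c hc
        obtain ⟨i, hi, rfl⟩ := (hC c).mp hc
        exact h i hi
      · exact fun h i hi => h _ ((hC _).mpr ⟨i, hi, rfl⟩)
    have hTz : ∀ t ∈ T, ∀ i < 2 * M + 6 + ε, t ≠ fromLeft (z i) := fun t ht i hi e =>
      hd t ((hT t).mpr ht) ((hC t).mpr ⟨i, hi, e⟩)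
    have eA : A.toOp = blockOp T α fun r _ =>
        if r (fromLeft (z 0)) = 1 then pauliZ else 1 := by
      rw [show A.toOp = _ from hα]
      refine diagonal_eq_blockOp (p := fun r => r (fromLeft (z 0)) = 1) (fun t ht y => ?_)
        fun t ht y => hα2 t (hTz t ht 0 (by omega)) y
      rw [flip_of_ne (hTz t ht 0 (by omega)).symm]
    have eB : B.toOp = blockOp T β fun r _ => if p r then pauliZ else 1 := by
      rw [show B.toOp = _ from hβ]
      refine diagonal_eq_blockOp (fun t ht y => (hβ2 t (hTz t ht)).1 y) fun t ht y => ?_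
      obtain ⟨h3, h4⟩ := (hβ2 t (hTz t ht)).2 y
      by_cases hy : p y
      · rw [h3 hy, if_pos hy, neg_one_mul]
      · rw [h4 hy, if_neg hy, one_mul]
    have hβ0 : ∀ r, β r ≠ 0 := by
      intro r hr
      have h := toOp_inverse_mul uB.lnn
      rw [hβ] at h
      have := congrFun (congrFun h r) r
      rw [mul_mono, hr, mul_zero, Matrix.one_apply_eq] at this
      exact zero_ne_one this
    have eB' : (inverse B).toOp = blockOp T (fun r => (β r)⁻¹) fun r _ =>
        if p r then pauliZ else 1 := by
      refine left_inv_eq_right_inv (toOp_inverse_mul uB.lnn) ?_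
      rw [show (testCircuit z M ε : Circuit k).toOp = _ from eB, blockOp_mul, ← blockOp_one T]
      refine blockOp_congr (fun r => mul_inv_cancel₀ (hβ0 r)) fun r i _ => ?_
      split_ifs
      · exact pauliZ_mul_self
      · exact one_mul _
    simp only [toOp_append, toOp_layer_rx hL hT, toOp_layer_rz hL hT, eA, eB, eB', blockOp_mul]
    rw [prod_controlled_eq_blockOp hCT W hL fun t ht => (hT t).mp ht]
    refine blockOp_congr (fun r => ?_) fun r i hi => ?_
    · have := hα1 r
      simp only [one_mul, mul_one]
      calc α r * β r * α r * (β r)⁻¹ = (α r * α r) * (β r * (β r)⁻¹) := by ring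
        _ = 1 := by rw [this, mul_inv_cancel₀ (hβ0 r), one_mul]
    · have hX : ∀ a : ℝ, rotX a * rotX (-a) = 1 := fun a => by
        rw [rotX_mul, add_neg_cancel, rotX_zero]
      have hZ : ∀ a : ℝ, rotZ a * rotZ (-a) = 1 := fun a => by
        rw [rotZ_mul, add_neg_cancel, rotZ_zero]
      have hX' : ∀ (a : ℝ) (N : Matrix (Fin 2) (Fin 2) ℂ), rotX (-a) * (rotX a * N) = N :=
        fun a N => by rw [← mul_assoc, rotX_mul, neg_add_cancel, rotX_zero, one_mul]
      have hZ' : ∀ (a : ℝ) (N : Matrix (Fin 2) (Fin 2) ℂ), rotZ a * (rotZ (-a) * N) = N :=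
        fun a N => by rw [← mul_assoc, hZ, one_mul]
      have hP' : ∀ N : Matrix (Fin 2) (Fin 2) ℂ, pauliZ * (pauliZ * N) = N :=
        fun N => by rw [← mul_assoc, pauliZ_mul_self, one_mul]
      have hi' : i ∈ L := (hT i).mpr hi
      by_cases hr : r (fromLeft (z 0)) = 1
      · by_cases hpr : p r
        · have hall := (hpC r hr).mp hpr
          rw [if_pos (show i ∈ L ∧ ∀ c ∈ C, r c = 1 from ⟨hi', hall⟩), hW i]
          have hcomm := pauliZ_rotX_commutator (a i)
          rw [show -4 * a i = θ i by simp only [a]; ring] at hcomm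
          rw [← hcomm]
          simp only [if_pos hr, if_pos hpr, mul_assoc]
        · rw [if_neg (show ¬(i ∈ L ∧ ∀ c ∈ C, r c = 1) from fun h => hpr ((hpC r hr).mpr h.2))]
          simp only [if_pos hr, if_neg hpr, mul_assoc, one_mul, hZ', hP', hX]
      · rw [if_neg (show ¬(i ∈ L ∧ ∀ c ∈ C, r c = 1) from fun h => hr (h.2 _ hz0))]
        by_cases hpr : p r
        · simp only [if_neg hr, if_pos hpr, mul_assoc, one_mul, hX', hZ', hP', hX]
        · simp only [if_neg hr, if_neg hpr, mul_assoc, one_mul, hZ', hX]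

end LNNCircuit

theorem mainTheorem10 (n m k : ℕ) (hn : 6 ≤ n) (hm : 1 ≤ m) (hk : n + m ≤ k)
    (ctrl : Fin n → Fin k) (tgt : Fin m → Fin k)
    (hpos : Function.Injective (Sum.elim ctrl tgt))
    (W : Fin m → Matrix.specialUnitaryGroup (Fin 2) ℂ) :
    ∃ c : LNNCircuit.Circuit k,
      c.IsLNN ∧
      c.toOp = LNNCircuit.multiControlledMultiTarget (Finset.univ.image ctrl) tgt
        (fun j => (W j : Matrix (Fin 2) (Fin 2) ℂ)) ∧
      c.cost LNNCircuit.Gate.isRotation = 8 * m ∧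
      c.cost LNNCircuit.Gate.isCNOT ≤ 24 * k + 14 * n - 40 ∧
      c.depth LNNCircuit.Gate.isCNOT ≤ 24 * k + 5 * n - 4 ∧
      c.cost LNNCircuit.Gate.isT ≤ 16 * n - 32 ∧
      c.depth LNNCircuit.Gate.isT ≤ 4 * n ∧
      c.cost LNNCircuit.Gate.isH ≤ 8 * n - 8 ∧
      c.depth LNNCircuit.Gate.isH ≤ 4 * n := by
  classical
  have : NeZero k := ⟨by omega⟩
  obtain ⟨M, ε, hε, rfl⟩ : ∃ M ε, ε ≤ 1 ∧ n = 2 * M + 6 + ε :=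
    ⟨(n - 6) / 2, n % 2, by omega, by omega⟩
  have hctrl : Function.Injective ctrl := hpos.comp Sum.inl_injective
  have htgt : Function.Injective tgt := hpos.comp Sum.inr_injective
  have hne : ∀ i j, ctrl i ≠ tgt j := fun i j h =>
    Sum.inl_ne_inr (hpos (a₁ := Sum.inl i) (a₂ := Sum.inr j) h)
  have hcard : (Finset.univ.image ctrl).card = 2 * M + 6 + ε := by
    rw [Finset.card_image_of_injective _ hctrl, Finset.card_univ, Fintype.card_fin]
  let e := (Finset.univ.image ctrl).orderEmbOfFin hcard
  let z : ℕ → ℕ := fun i => if h : i < 2 * M + 6 + ε then (e ⟨i, h⟩).val else 0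
  have hz : ∀ i (h : i < 2 * M + 6 + ε), z i = (e ⟨i, h⟩).val := fun i h => dif_pos h
  have hsorted : LNNCircuit.IsSorted z (2 * M + 6 + ε) k := by
    constructor
    · intro i j hij hj
      rw [hz i (by omega), hz j hj]
      exact e.strictMono (show (⟨i, by omega⟩ : Fin _) < ⟨j, hj⟩ from hij)
    · intro i hi
      rw [hz i hi]
      exact Fin.isLt _
  have hC : ∀ c, c ∈ Finset.univ.image ctrl ↔
      ∃ i < 2 * M + 6 + ε, c = LNNCircuit.fromLeft (z i) := by
    intro c
    rw [← Finset.mem_coe, ← Finset.range_orderEmbOfFin _ hcard]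
    constructor
    · rintro ⟨i, rfl⟩
      refine ⟨i, i.isLt, ?_⟩
      rw [hz i i.isLt, LNNCircuit.fromLeft_val]
    · rintro ⟨i, hi, rfl⟩
      refine ⟨⟨i, hi⟩, ?_⟩
      rw [hz i hi, LNNCircuit.fromLeft_val]
  obtain ⟨c, hc, hop⟩ := LNNCircuit.exists_circuit hε hsorted hC (L := List.ofFn tgt)
    (List.nodup_ofFn.mpr htgt)
    (by
      intro t ht hmem
      obtain ⟨j, rfl⟩ := (List.mem_ofFn' _ _).mp ht
      obtain ⟨i, -, hi⟩ := Finset.mem_image.mp hmem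
      exact hne i j hi)
    (W := fun t => ((Function.extend tgt W 1 t : Matrix.specialUnitaryGroup (Fin 2) ℂ) :
      Matrix (Fin 2) (Fin 2) ℂ)) (fun t => Subtype.property _)
  have hk' : 2 * M + 6 + ε ≤ k := by omega
  refine ⟨c, hc.lnn, ?_, ?_, hc.cnot.trans (by omega), hc.cnotDepth.trans (by omega),
    hc.t.trans (by omega), hc.tDepth, hc.h.trans (by omega), hc.hDepth⟩
  · rw [hop, LNNCircuit.multiControlledMultiTarget, List.map_ofFn]
    congr 2
    funext j
    simp only [Function.comp_apply, htgt.extend_apply]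
  · rw [hc.rot, List.length_ofFn]
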